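/- A \emph{trinity} is a triangulation $\mathcal T$ of a closed connected oriented surface $\Sigma$ (several edges may have the same endpoints) whose vertices are colored red, green and blue so that the endpoints of every edge have different colors. Each edge is given the color that does not occur among its endpoints. The triangles are colored white or black according to the cyclic order of the three colors around them, so that every edge separates a white triangle from a black one. The trinity is \emph{toric} if $\Sigma$ is the torus. A \emph{Tutte matching} of a toric trinity is a perfect matching between the set of all white triangles and the set of all vertices in which each white triangle is matched to one of its own vertices. For a color $X$, let $G_X$ be the graph formed by the edges of color $X$ and the vertices of the other two colors, and let $G_X^*$ be its dual graph on $\Sigma$: its vertices are the vertices of color $X$, and for each edge $\varepsilon$ of color $X$ it has one directed edge crossing $\varepsilon$, which leads from the vertex of color $X$ of the black triangle at $\varepsilon$ to the vertex of color $X$ of the white triangle at $\varepsilon$. A \emph{wreath} in $G_X^*$ is a set $W$ of edges of $G_X^*$ such that every vertex of color $X$ has exactly one edge of $W$ pointing to it and no cycle formed by edges of $W$ separates $\Sigma$. (Loops and pairs of parallel edges count as cycles.) A Tutte matching \emph{extends} $W$ if for each edge of $W$ it matches the white triangle that the edge passes through to the vertex that the edge points to. \textbf{Theorem.} Let $\mathcal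 T$ be a toric trinity and let $X$ be any of the three colors (for instance red). \begin{enumerate} \item If $W$ is a wreath in $G_X^*$ that contains exactly $k$ cycles, then exactly $2^k$ Tutte matchings of $\mathcal T$ extend $W$. \item There exists a wreath in $G_X^*$. \item Consequently, $\mathcal T$ has a Tutte matching. \end{enumerate} -/

import Mathlib

/-- The three colours of the vertices of a trinity. An edge is coloured by the colour that does
not occur among its endpoints. -/
inductive TrinityColor : Type
  | red
  | green
  | blue
  deriving DecidableEq

instance : Fintype TrinityColor :=
  ⟨{TrinityColor.red, TrinityColor.green, TrinityColor.blue}, by rintro ⟨⟩ <;> simp⟩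

/-- A trinity (a triangulation of a closed oriented surface whose vertices are properly coloured
with three colours) with set of white triangles `W` and set of black triangles `B`.

Every triangle has one corner and one (opposite) edge of each colour. In a white triangle the
cyclic order of the colours, with respect to the orientation, is opposite to that in a black one,
so every edge lies on exactly one white and exactly one black triangle. The triangulation is thus
given by its gluing data: for every colour `c` and every white triangle `w`, the black triangle
`glue c w` on the other side of the edge of colour `c` of `w`; the edges are identified so that the
colours of their endpoints agree. As usual, several edges may have the same two endpoints. -/
structure Trinity (W B : Type*) where
  glue : TrinityColor → W ≃ B

namespace Trinity

variable {W B : Type*} (T : Trinity W B)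

/-- Two triangles, a white one and a black one, that are glued along an edge. -/
def GluedTriangles (s t : W ⊕ B) : Prop :=
  ∃ (w : W) (d : TrinityColor), s = Sum.inl w ∧ t = Sum.inr (T.glue d w)

/-- The identification of corners (pairs of a triangle and a colour) in the surface: if two
triangles are glued along an edge of colour `d`, then their corners of colour `c` are identified
for the two colours `c ≠ d`. -/
def GluedCorners (p q : (W ⊕ B) × TrinityColor) : Prop :=
  ∃ (w : W) (d c : TrinityColor),
    d ≠ c ∧ p = (Sum.inl w, c) ∧ q = (Sum.inr (T.glue d w), c)

/-- The vertices of the triangulation: the corners of the triangles up to the equivalence relation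
generated by the gluing. -/
def Vertex : Type _ := Quot T.GluedCorners

/-- The vertex of colour `c` of the triangle `t`. -/
def vertexOf (t : W ⊕ B) (c : TrinityColor) : T.Vertex := Quot.mk _ (t, c)

/-- The colour of a vertex. -/
def color : T.Vertex → TrinityColor :=
  Quot.lift Prod.snd (by rintro _ _ ⟨w, d, c, _, rfl, rfl⟩; rfl)

/-- The vertex of colour `c` of the white triangle `w`. -/
def whiteVertex (w : W) (c : TrinityColor) : T.Vertex := T.vertexOf (Sum.inl w) c

/-- The vertex of colour `c` of the black triangle `b`. -/
def blackVertex (b : B) (c : TrinityColor) : T.Vertex := T.vertexOf (Sum.inr b) c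

/-- The Euler characteristic (vertices minus edges plus triangles). An edge is given by the
unique white triangle on which it lies, together with its colour. -/
noncomputable def eulerChar : ℤ :=
  (Nat.card T.Vertex : ℤ) - (Nat.card (W × TrinityColor) : ℤ) + (Nat.card (W ⊕ B) : ℤ)

/-- The surface of the trinity is the torus: the connected closed orientable surface of Euler
characteristic `0`. -/
def IsToric : Prop :=
  (SimpleGraph.fromRel T.GluedTriangles).Connected ∧ T.eulerChar = 0

/-- A Tutte matching: a perfect matching between the white triangles and the vertices in which
every white triangle is matched to one of its own vertices. -/
def TutteMatching : Type _ :=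
  {m : W ≃ T.Vertex // ∀ w : W, ∃ c : TrinityColor, m w = T.whiteVertex w c}

/-! ### The directed graph dual to the graph of edges of colour `c`

The graph `G_c` has as vertices the vertices of the two colours other than `c`, and as edges the
edges of colour `c`. Its dual `G_c^*` is the directed graph whose vertices are the vertices of
colour `c` and which has one edge across each edge of colour `c`. The edges of both graphs are
indexed by the white triangles. -/

/-- The tail of the edge of `G_c^*` through the white triangle `w`: the edge starts at the vertex
of colour `c` of the black triangle on the other side of the edge of colour `c` of `w`. -/
def tail (c : TrinityColor) (w : W) : T.Vertex := T.blackVertex (T.glue c w) c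

/-- The head of the edge of `G_c^*` through the white triangle `w`. -/
def head (c : TrinityColor) (w : W) : T.Vertex := T.whiteVertex w c

/-- `C` is the edge set of a cycle of the multigraph underlying `G_c^*`: a closed walk of length
`m ≥ 1` without repeated vertices and edges. Loops are cycles of length `1`, and two different
edges with the same endpoints form a cycle of length `2`. -/
def IsCycle (c : TrinityColor) (C : Set W) : Prop :=
  ∃ (m : ℕ) (v : ZMod m → T.Vertex) (e : ZMod m → W),
    0 < m ∧ Function.Injective v ∧ Function.Injective e ∧ Set.range e = C ∧
      ∀ i : ZMod m, s(T.tail c (e i), T.head c (e i)) = s(v i, v (i + 1))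

/-- The (simple graph underlying the) graph `G_c` with the edges crossed by `C` removed. Its
vertices correspond to the regions into which `G_c^*` divides the surface, two regions being
adjacent if they lie on the two sides of an edge of `G_c^*` that does not belong to `C`. Hence its
connected components correspond to those of the complement of `C` in the surface. -/
def complementGraph (c : TrinityColor) (C : Set W) :
    SimpleGraph {x : T.Vertex // T.color x ≠ c} where
  Adj x y := x ≠ y ∧ ∃ w : W, w ∉ C ∧
    (∃ d, x.1 = T.whiteVertex w d) ∧ (∃ d, y.1 = T.whiteVertex w d)
  symm := ⟨fun _ _ ⟨hne, w, hw, hx, hy⟩ => ⟨hne.symm, w, hw, hy, hx⟩⟩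
  loopless := ⟨fun _ h => h.1 rfl⟩

/-- A set of edges of `G_c^*` separates the surface if its complement in the surface is
disconnected. -/
def IsSeparating (c : TrinityColor) (C : Set W) : Prop :=
  ¬ (T.complementGraph c C).Connected

/-- A wreath in `G_c^*`: a set of edges such that exactly one of them points to each vertex of
colour `c`, and which contains no separating cycle. -/
def IsWreath (c : TrinityColor) (S : Set W) : Prop :=
  (∀ x : T.Vertex, T.color x = c → ∃! w : W, w ∈ S ∧ T.head c w = x) ∧
    ∀ C : Set W, C ⊆ S → T.IsCycle c C → ¬ T.IsSeparating c C

/-- The number of cycles contained in a set of edges of `G_c^*`. -/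
noncomputable def numCycles (c : TrinityColor) (S : Set W) : ℕ :=
  {C : Set W | C ⊆ S ∧ T.IsCycle c C}.ncard

/-- The Tutte matching `m` extends the set `S` of edges of `G_c^*`: the edge through the white
triangle `w`, read as an arrow, stands for matching `w` to the vertex at its head. -/
def Extends (c : TrinityColor) (m : T.TutteMatching) (S : Set W) : Prop :=
  ∀ w ∈ S, m.1 w = T.head c w

end Trinity

/-! Call the vertices of colour `c` faces of the graph `G_c`; its other vertices form `U`. A choice
of one incoming dual edge per face is a section `s` of `hd`, and its cycles are the cycles of the
map `pred s`. Euler characteristic 0 gives `|W| = |X| + |U|`, so as many edges of `G_c` avoid the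
wreath as there are vertices in `U`. Extending the wreath means matching each of these edges to one
of its ends, bijectively onto `U`. That can be done in two ways on every component that contains
exactly one cycle.

Geometrically, `k` disjoint nonseparating cycles cut the torus into `k` annuli, and the trees of the
wreath do not change the homotopy type, so `G_c` minus the wreath has `k` unicyclic components. The
proof obtains this from dimensions of real vector spaces. The cycle space `flows` of the cut graph
has dimension equal to the number of components (`finrank_flows`, `finrank_cutFun`). Since no wreath
cycle bounds, there are at most `k` components (`finrank_cutFun_le`); since every cycle has two
distinguishable sides, there are at least `k` (`finrank_invFun_le`). Every component carries a
nonzero flow (`exists_flow_of_component`), hence exactly one up to scalars, and `card_matchings`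
counts.

For existence, take a mod 2 cocycle `φ` on the dual graph that is not a coboundary, and twist the
Laplacian by the signs of `φ`. Its determinant is nonzero (`exists_section_det_ne_zero`) and expands
by multilinearity into a sum over all sections. The term of a section vanishes if `φ` sums to 0
along one of its cycles (`det_eq_zero_of_sum_eq_zero`), and a separating cycle has this property. So
a section with nonzero term is a wreath. -/

section

open Function

/-! ### Self-maps and permutations of finite sets -/

/-- Some iterate of a self-map of a finite type takes only periodic values. -/
theorem exists_iterate_mem_periodicPts {X : Type*} [Finite X] (f : X → X) :
    ∃ M, ∀ v, f^[M] v ∈ periodicPts f := by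
  obtain ⟨i, j, hij, h⟩ := Finite.exists_ne_map_eq_of_infinite (fun n : ℕ => f^[n])
  wlog hlt : i < j generalizing i j
  · exact this j i hij.symm h.symm (lt_of_le_of_ne (not_lt.1 hlt) hij.symm)
  refine ⟨i, fun v => mk_mem_periodicPts (Nat.sub_pos_of_lt hlt) ?_⟩
  change f^[j - i] (f^[i] v) = f^[i] v
  rw [← iterate_add_apply, Nat.sub_add_cancel hlt.le]
  exact (congrFun h v).symm

theorem periodicPts_injOn {X : Type*} {f : X → X} {u v : X} (hu : u ∈ periodicPts f)
    (hv : v ∈ periodicPts f) (h : f u = f v) : u = v :=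
  (bijOn_periodicPts f).injOn hu hv h

theorem exists_periodicPts_iterate_eq {X : Type*} {f : X → X} (n : ℕ) {v : X}
    (hv : v ∈ periodicPts f) : ∃ u ∈ periodicPts f, f^[n] u = v := by
  induction n generalizing v with
  | zero => exact ⟨v, hv, rfl⟩
  | succ n ih =>
    obtain ⟨u, hu, rfl⟩ := (bijOn_periodicPts f).surjOn hv
    obtain ⟨t, ht, rfl⟩ := ih hu
    exact ⟨t, ht, iterate_succ_apply' f n t⟩

theorem iterate_mem_periodicPts {X : Type*} {f : X → X} (n : ℕ) {v : X}
    (hv : v ∈ periodicPts f) : f^[n] v ∈ periodicPts f := by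
  induction n with
  | zero => exact hv
  | succ n ih =>
    rw [iterate_succ_apply']
    exact (bijOn_periodicPts f).mapsTo ih

open Classical in
/-- A sum over the periodic points is invariant under the map. -/
theorem sum_periodicPts_comp {X : Type*} [Fintype X] (f : X → X) (g : X → ℝ) :
    (∑ v, if v ∈ periodicPts f then g (f v) else 0) =
      ∑ v, if v ∈ periodicPts f then g v else 0 := by
  rw [← Finset.sum_filter, ← Finset.sum_filter]
  refine Finset.sum_bij (fun v _ => f v) ?_ ?_ ?_ ?_
  · intro v hv
    simpa using (bijOn_periodicPts f).mapsTo (by simpa using hv)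
  · intro u hu v hv h
    exact periodicPts_injOn (by simpa using hu) (by simpa using hv) h
  · intro v hv
    obtain ⟨u, hu, rfl⟩ := (bijOn_periodicPts f).surjOn (show v ∈ periodicPts f by simpa using hv)
    exact ⟨u, by simpa using hu, rfl⟩
  · intros; rfl

/-- A function orthogonal to all functions invariant under a permutation is a coboundary. -/
theorem exists_sub_eq_of_orthogonal {W : Type*} [Fintype W] (σ : Equiv.Perm W) (h : W → ℝ)
    (hh : ∀ F : W → ℝ, (∀ w, F (σ w) = F w) → ∑ w, F w * h w = 0) :
    ∃ u : W → ℝ, ∀ w, u (σ w) - u w = h w := by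
  classical
  set n := orderOf σ with hn
  have hpos : 0 < n := orderOf_pos σ
  have hσ : σ ^ n = 1 := pow_orderOf_eq_one σ
  set A : W → ℝ := fun x => ∑ j ∈ Finset.range n, h ((σ ^ j) x) with hA
  have hAinv : ∀ w, A (σ w) = A w := by
    intro w
    have h1 := Finset.sum_range_succ (fun j => h ((σ ^ j) w)) n
    have h2 := Finset.sum_range_succ' (fun j => h ((σ ^ j) w)) n
    have h3 : A (σ w) = ∑ j ∈ Finset.range n, h ((σ ^ (j + 1)) w) := by
      simp [hA, pow_succ, Equiv.Perm.mul_apply]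
    rw [h3]
    simp only [hσ, pow_zero, Equiv.Perm.coe_one, id_eq] at h1 h2
    simp only [hA]
    linarith
  have hApow : ∀ (j : ℕ) w, A ((σ ^ j) w) = A w := by
    intro j
    induction j with
    | zero => simp
    | succ j ih =>
      intro w
      rw [pow_succ, Equiv.Perm.mul_apply, ih, hAinv]
  -- The orbit sum `A` is itself invariant, so the hypothesis applies to it and gives its square
  -- norm.
  have hsq : ∑ w, A w * A w = 0 := by
    have : ∀ w, A w * A w = ∑ j ∈ Finset.range n, A ((σ ^ j) w) * h ((σ ^ j) w) := by
      intro w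
      simp only [hApow, ← Finset.mul_sum]
      rfl
    simp only [this]
    rw [Finset.sum_comm]
    refine Finset.sum_eq_zero fun j _ => ?_
    rw [Equiv.sum_comp (σ ^ j) (fun w => A w * h w)]
    exact hh A hAinv
  have hA0 : ∀ w, A w = 0 := by
    intro w
    have := (Finset.sum_eq_zero_iff_of_nonneg (fun w _ => mul_self_nonneg (A w))).1 hsq w
      (Finset.mem_univ w)
    exact mul_self_eq_zero.1 this
  -- Shifting `w` to `σ w` lowers each weight `j` by one, which costs an orbit sum, that is 0; the
  -- wrap-around term contributes `n * h w`.
  refine ⟨fun w => (1 / (n : ℝ)) * ∑ j ∈ Finset.range n, (j : ℝ) * h ((σ ^ j) w), fun w => ?_⟩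
  have h1 := Finset.sum_range_succ (fun j : ℕ => (j : ℝ) * h ((σ ^ j) w)) n
  have h2 := Finset.sum_range_succ' (fun j : ℕ => (j : ℝ) * h ((σ ^ j) w)) n
  have h3 : ∑ j ∈ Finset.range n, ((j + 1 : ℕ) : ℝ) * h ((σ ^ (j + 1)) w) =
      (∑ j ∈ Finset.range n, (j : ℝ) * h ((σ ^ j) (σ w))) + A (σ w) := by
    simp only [hA, ← Finset.sum_add_distrib]
    refine Finset.sum_congr rfl fun j _ => ?_
    rw [pow_succ, Equiv.Perm.mul_apply]
    push_cast
    ring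
  rw [hA0] at h3
  have hn0 : (n : ℝ) ≠ 0 := by positivity
  simp only [hσ, Nat.cast_zero, zero_mul, Equiv.Perm.coe_one, id_eq] at h1 h2
  have : (∑ j ∈ Finset.range n, (j : ℝ) * h ((σ ^ j) (σ w))) -
      ∑ j ∈ Finset.range n, (j : ℝ) * h ((σ ^ j) w) = n * h w := by linarith
  field_simp
  linarith

/-! ### Bipartite maps on the torus -/

/-- A bipartite map on a closed surface, in terms of its edges `W`: the permutations `ε` and `δ`
turn the edges around their first and second endpoints `a` and `b`, and `hd` is the face at a
fixed side of an edge. The last fields express that the vertices and faces are the orbits of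
`ε`, `δ` and `δ * ε⁻¹`, that the surface is connected and that its Euler characteristic is `0`. -/
structure ToricMap (W X U : Type*) where
  δ : Equiv.Perm W
  ε : Equiv.Perm W
  hd : W → X
  a : W → U
  b : W → U
  hd_surjective : Surjective hd
  a_ε : ∀ w, a (ε w) = a w
  b_δ : ∀ w, b (δ w) = b w
  hd_δ : ∀ w, hd (δ w) = hd (ε w)
  a_ne_b : ∀ w w', a w ≠ b w'
  exists_end : ∀ x : U, ∃ w, a w = x ∨ b w = x
  lift_U : ∀ F G : W → ℝ, (∀ w, F (ε w) = F w) → (∀ w, G (δ w) = G w) →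
    ∃ f : U → ℝ, (∀ w, f (a w) = F w) ∧ ∀ w, f (b w) = G w
  lift_X : ∀ F : W → ℝ, (∀ w, F (δ w) = F (ε w)) → ∃ f : X → ℝ, ∀ w, f (hd w) = F w
  const_of_invariant : ∀ F : W → ℝ, (∀ w, F (δ w) = F w) → (∀ w, F (ε w) = F w) →
    ∀ w w', F w = F w'
  nonempty : Nonempty W
  card_eq : Nat.card W = Nat.card X + Nat.card U

namespace ToricMap

variable {W X U : Type*} (H : ToricMap W X U)

/-- The face on the other side of an edge. -/
def tl (w : W) : X := H.hd (H.ε w)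

/-- A set of edges, seen as a chain in the dual map, is the boundary of a real 2-chain. -/
def IsBoundary (C : Set W) : Prop :=
  ∃ f : U → ℝ, ∀ w, f (H.a w) - f (H.b w) = C.indicator 1 w

/-- The face preceding a face, given a choice of an incoming edge for each face. -/
def pred (s : X → W) (v : X) : X := H.tl (s v)

/-- The cycle through a periodic face formed by the chosen edges. -/
def orbitEdges (s : X → W) (v : X) : Set W := {w | ∃ j : ℕ, w = s ((H.pred s)^[j] v)}

/-- The graph of edges outside a set. -/
def cut (C : Set W) : SimpleGraph U where
  Adj x y := x ≠ y ∧ ∃ w, w ∉ C ∧ (x = H.a w ∨ x = H.b w) ∧ (y = H.a w ∨ y = H.b w)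
  symm := ⟨fun _ _ ⟨h, w, hw, hx, hy⟩ => ⟨h.symm, w, hw, hy, hx⟩⟩
  loopless := ⟨fun _ h => h.1 rfl⟩

theorem const_of_a_eq_b {f : U → ℝ} (hf : ∀ w, f (H.a w) = f (H.b w)) (x y : U) : f x = f y := by
  have h : ∀ w w', f (H.a w) = f (H.a w') := by
    refine H.const_of_invariant (fun w => f (H.a w)) ?_ ?_
    · intro w
      simp only [hf, H.b_δ]
    · intro w
      simp only [H.a_ε]
  have h' : ∀ x, ∃ w, f x = f (H.a w) := by
    intro x
    obtain ⟨w, rfl | rfl⟩ := H.exists_end x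
    · exact ⟨w, rfl⟩
    · exact ⟨w, (hf w).symm⟩
  obtain ⟨w, hw⟩ := h' x
  obtain ⟨w', hw'⟩ := h' y
  rw [hw, hw', h]

theorem eq_of_reachable {C : Set W} {f : U → ℝ} (hf : ∀ w, w ∉ C → f (H.a w) = f (H.b w))
    {x y : U} (h : (H.cut C).Reachable x y) : f x = f y := by
  obtain ⟨p⟩ := h
  induction p with
  | nil => rfl
  | cons hadj _ ih =>
    rw [← ih]
    obtain ⟨-, w, hw, rfl | rfl, rfl | rfl⟩ := hadj
    · rfl
    · exact hf w hw
    · exact (hf w hw).symm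
    · rfl

theorem reachable_a_b {C : Set W} {w : W} (hw : w ∉ C) : (H.cut C).Reachable (H.a w) (H.b w) :=
  SimpleGraph.Adj.reachable ⟨H.a_ne_b w w, w, hw, Or.inl rfl, Or.inr rfl⟩

/-- A potential for `C` is constant on the components of the cut graph, yet jumps by 1 across each
edge of `C`. -/
theorem not_connected_of_isBoundary {C : Set W} (hC : C.Nonempty) (h : H.IsBoundary C) :
    ¬ (H.cut C).Connected := by
  rintro hconn
  obtain ⟨f, hf⟩ := h
  obtain ⟨w, hw⟩ := hC
  have h1 := hf w
  have h2 : f (H.a w) = f (H.b w) := by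
    refine H.eq_of_reachable (C := C) (fun w' hw' => ?_) (hconn.preconnected _ _)
    have := hf w'
    rw [Set.indicator_of_notMem hw'] at this
    linarith
  rw [Set.indicator_of_mem hw, h2] at h1
  simp at h1

section Fintype

variable [Fintype W]

theorem sum_ε_comp (F : W → ℝ) (g : U → ℝ) :
    ∑ w, F (H.ε w) * g (H.a w) = ∑ w, F w * g (H.a w) := by
  rw [← Equiv.sum_comp H.ε (fun w => F w * g (H.a w))]
  simp only [H.a_ε]

theorem sum_δ_comp (F : W → ℝ) (g : U → ℝ) :
    ∑ w, F (H.δ w) * g (H.b w) = ∑ w, F w * g (H.b w) := by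
  rw [← Equiv.sum_comp H.δ (fun w => F w * g (H.b w))]
  simp only [H.b_δ]

/-- Summation by parts around the faces: reindex one sum by `ε` and the other by `δ`, both of which
carry `w` to an edge with head `tl w`. -/
theorem sum_hd_mul_sub (p : X → ℝ) (D E : W → ℝ) :
    ∑ w, p (H.hd w) * (D w - E w) = ∑ w, p (H.tl w) * (D (H.ε w) - E (H.δ w)) := by
  simp only [mul_sub, Finset.sum_sub_distrib]
  rw [← Equiv.sum_comp H.ε (fun w => p (H.hd w) * D w),
    ← Equiv.sum_comp H.δ (fun w => p (H.hd w) * E w)]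
  simp only [H.hd_δ]
  rfl

/-- Boundaries are cycles. -/
theorem sum_boundary_hd (f : U → ℝ) (p : X → ℝ) :
    ∑ w, p (H.hd w) * (f (H.a w) - f (H.b w)) = ∑ w, p (H.tl w) * (f (H.a w) - f (H.b w)) := by
  have := H.sum_hd_mul_sub p (fun w => f (H.a w)) (fun w => f (H.b w))
  simpa only [H.a_ε, H.b_δ] using this

end Fintype

end ToricMap

/-! ### Linear algebra: the orthogonal complement of a range -/

/-- The vectors orthogonal to the range of a linear map. -/
def orthRange {K m n : Type*} [Field K] [Fintype m] (T : (n → K) →ₗ[K] (m → K)) :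
    Submodule K (m → K) where
  carrier := {φ | ∀ y, ∑ w, φ w * T y w = 0}
  add_mem' := by
    intro φ ψ hφ hψ y
    simp only [Pi.add_apply, add_mul, Finset.sum_add_distrib, hφ y, hψ y, add_zero]
  zero_mem' := by intro y; simp
  smul_mem' := by
    intro r φ hφ y
    simp only [Pi.smul_apply, smul_eq_mul, mul_assoc, ← Finset.mul_sum, hφ y, mul_zero]

/-- Row rank equals column rank. -/
theorem finrank_orthRange {K m n : Type*} [Field K] [Fintype m] [Fintype n]
    (T : (n → K) →ₗ[K] (m → K)) :
    Module.finrank K (orthRange T) + Fintype.card n =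
      Module.finrank K (LinearMap.ker T) + Fintype.card m := by
  classical
  set M := LinearMap.toMatrix' T with hM
  have hT : M.mulVecLin = T := Matrix.toLin'_toMatrix' T
  have hker : orthRange T = LinearMap.ker M.transpose.mulVecLin := by
    ext φ
    rw [LinearMap.mem_ker, Matrix.mulVecLin_apply, Matrix.mulVec_transpose]
    have key : ∀ y, ∑ w, φ w * T y w = (Matrix.vecMul φ M) ⬝ᵥ y := by
      intro y
      rw [← Matrix.dotProduct_mulVec, ← Matrix.mulVecLin_apply, hT]
      rfl
    constructor
    · intro h
      refine dotProduct_eq_zero _ fun y => ?_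
      rw [← key]
      exact h y
    · intro h y
      rw [key, h, zero_dotProduct]
  have h1 := LinearMap.finrank_range_add_finrank_ker M.mulVecLin
  have h2 := LinearMap.finrank_range_add_finrank_ker M.transpose.mulVecLin
  have h3 := M.rank_transpose
  rw [Matrix.rank, Matrix.rank] at h3
  rw [Module.finrank_fintype_fun_eq_card] at h1 h2
  rw [hker, ← hT]
  omega

/-! ### Boundaries supported on the chosen edges -/

namespace ToricMap

variable {W X U : Type*} (H : ToricMap W X U) {s : X → W}

theorem section_injective (hs : ∀ v, H.hd (s v) = v) : Injective s :=
  fun u v h => by rw [← hs u, ← hs v, h]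

theorem sum_section [Fintype W] [Fintype X] (hs : ∀ v, H.hd (s v) = v) (k : W → ℝ)
    (hk : ∀ w, w ∉ Set.range s → k w = 0) : ∑ w, k w = ∑ v, k (s v) :=
  (Fintype.sum_of_injective s (H.section_injective hs) _ _ (fun w hw => hk w hw)
    (fun _ => rfl)).symm

section Flow

variable [Finite W] {f : U → ℝ}

open Classical in
-- Kirchhoff's law at the face `v`: a boundary is a cycle, the only chosen edge into `v` is `s v`,
-- and those leaving `v` are the `s u` with `pred s u = v`.
theorem flow_eq_sum [Fintype X] (hs : ∀ v, H.hd (s v) = v)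
    (hf : ∀ w, w ∉ Set.range s → f (H.a w) = f (H.b w))
    (v : X) :
    f (H.a (s v)) - f (H.b (s v)) =
      ∑ u, if H.pred s u = v then f (H.a (s u)) - f (H.b (s u)) else 0 := by
  have := Fintype.ofFinite W
  have h := H.sum_boundary_hd f (Pi.single v 1)
  rw [H.sum_section hs _ (fun w hw => by rw [hf w hw, sub_self, mul_zero]),
    H.sum_section hs _ (fun w hw => by rw [hf w hw, sub_self, mul_zero])] at h
  simp only [hs, Pi.single_apply, ite_mul, one_mul, zero_mul, Finset.sum_ite_eq', Finset.mem_univ,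
    if_true] at h
  convert h
  rfl

/-- A face that no chosen edge leaves has no outflow, hence no inflow. By induction the flow
vanishes on all the trees hanging from the cycles. -/
theorem flow_eq_zero [Finite X] (hs : ∀ v, H.hd (s v) = v)
    (hf : ∀ w, w ∉ Set.range s → f (H.a w) = f (H.b w))
    {v : X} (hv : v ∉ periodicPts (H.pred s)) :
    f (H.a (s v)) = f (H.b (s v)) := by
  classical
  have := Fintype.ofFinite X
  have key : ∀ (j : ℕ) (v : X), v ∉ Set.range (H.pred s)^[j] →
      f (H.a (s v)) - f (H.b (s v)) = 0 := by
    intro j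
    induction j with
    | zero => intro v hv; exact absurd ⟨v, rfl⟩ hv
    | succ j ih =>
      intro v hv
      rw [H.flow_eq_sum hs hf]
      refine Finset.sum_eq_zero fun u _ => ?_
      split_ifs with hu
      · refine ih u ?_
        rintro ⟨t, rfl⟩
        exact hv ⟨t, by rw [iterate_succ_apply', hu]⟩
      · rfl
  obtain ⟨M, hM⟩ := exists_iterate_mem_periodicPts (H.pred s)
  refine sub_eq_zero.1 (key M v ?_)
  rintro ⟨u, rfl⟩
  exact hv (hM u)

/-- Of the edges leaving `pred s v`, only the one on the cycle can carry flow. -/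
theorem flow_pred [Finite X] (hs : ∀ v, H.hd (s v) = v)
    (hf : ∀ w, w ∉ Set.range s → f (H.a w) = f (H.b w))
    {v : X} (hv : v ∈ periodicPts (H.pred s)) :
    f (H.a (s (H.pred s v))) - f (H.b (s (H.pred s v))) = f (H.a (s v)) - f (H.b (s v)) := by
  classical
  have := Fintype.ofFinite X
  rw [H.flow_eq_sum hs hf, Finset.sum_eq_single v]
  · simp
  · intro u _ hu
    split_ifs with h
    · rw [H.flow_eq_zero hs hf, sub_self]
      exact fun hu' => hu (periodicPts_injOn hu' hv h)
    · rfl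
  · simp

theorem flow_iterate [Finite X] (hs : ∀ v, H.hd (s v) = v)
    (hf : ∀ w, w ∉ Set.range s → f (H.a w) = f (H.b w))
    {v : X} (hv : v ∈ periodicPts (H.pred s)) (j : ℕ) :
    f (H.a (s ((H.pred s)^[j] v))) - f (H.b (s ((H.pred s)^[j] v))) =
      f (H.a (s v)) - f (H.b (s v)) := by
  induction j with
  | zero => rfl
  | succ j ih => rw [iterate_succ_apply', H.flow_pred hs hf (iterate_mem_periodicPts j hv), ih]

/-- The jump of `f` is constant along the cycle; dividing by it makes `f` a 2-chain bounded by this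
cycle alone. -/
theorem isBoundary_orbitEdges [Finite X] (hs : ∀ v, H.hd (s v) = v)
    (hf : ∀ w, w ∉ Set.range s → f (H.a w) = f (H.b w))
    {v : X} (hv : v ∈ periodicPts (H.pred s))
    (hne : f (H.a (s v)) ≠ f (H.b (s v)))
    (hsupp : ∀ u ∈ periodicPts (H.pred s), f (H.a (s u)) ≠ f (H.b (s u)) →
      ∃ j : ℕ, u = (H.pred s)^[j] v) :
    H.IsBoundary (H.orbitEdges s v) := by
  have hne' := sub_ne_zero.2 hne
  refine ⟨fun x => f x / (f (H.a (s v)) - f (H.b (s v))), fun w => ?_⟩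
  rw [← sub_div]
  by_cases hw : w ∈ H.orbitEdges s v
  · rw [Set.indicator_of_mem hw]
    obtain ⟨j, rfl⟩ := hw
    rw [H.flow_iterate hs hf hv, div_self hne']
    rfl
  · rw [Set.indicator_of_notMem hw, div_eq_zero_iff]
    left
    by_contra h
    rw [sub_eq_zero] at h
    have hr : w ∈ Set.range s := by
      by_contra h'
      exact h (hf w h')
    obtain ⟨u, rfl⟩ := hr
    have hu : u ∈ periodicPts (H.pred s) := by
      by_contra h'
      exact h (H.flow_eq_zero hs hf h')
    obtain ⟨j, rfl⟩ := hsupp u hu h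
    exact hw ⟨j, rfl⟩

end Flow

/-- The complement of a separating cycle is the disjoint union of two parts such that the cycle
consists of the edges between them. -/
theorem exists_side [Finite W] [Finite X] (hs : ∀ v, H.hd (s v) = v) {v : X}
    (hv : v ∈ periodicPts (H.pred s)) (h : ¬ (H.cut (H.orbitEdges s v)).Connected) :
    ∃ K : Set U, ∀ w, w ∈ H.orbitEdges s v ↔ ¬ (H.a w ∈ K ↔ H.b w ∈ K) := by
  classical
  obtain ⟨w₀⟩ := H.nonempty
  have : Nonempty U := ⟨H.a w₀⟩
  rw [SimpleGraph.connected_iff] at h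
  simp only [this, and_true, SimpleGraph.Preconnected, not_forall] at h
  obtain ⟨x, y, hxy⟩ := h
  set K : Set U := {z | (H.cut (H.orbitEdges s v)).Reachable x z} with hK
  have hx : x ∈ K := SimpleGraph.Reachable.refl x
  have hout : ∀ w, w ∉ H.orbitEdges s v → (H.a w ∈ K ↔ H.b w ∈ K) := fun w hw =>
    ⟨fun h => h.trans (H.reachable_a_b hw), fun h => h.trans (H.reachable_a_b hw).symm⟩
  set f : U → ℝ := K.indicator 1 with hfdef
  have hmem : ∀ z, f z = if z ∈ K then 1 else 0 := fun z => by simp [hfdef, Set.indicator_apply]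
  have hiff : ∀ w, f (H.a w) = f (H.b w) ↔ (H.a w ∈ K ↔ H.b w ∈ K) := by
    intro w
    rw [hmem, hmem]
    by_cases h1 : H.a w ∈ K <;> by_cases h2 : H.b w ∈ K <;> simp [h1, h2]
  have hf : ∀ w, w ∉ Set.range s → f (H.a w) = f (H.b w) := by
    intro w hw
    rw [hiff]
    refine hout w ?_
    rintro ⟨j, rfl⟩
    exact hw ⟨_, rfl⟩
  refine ⟨K, fun w => ⟨fun hw => ?_, fun hw => by_contra fun h => hw (hout w h)⟩⟩
  rw [← hiff]
  obtain ⟨j, rfl⟩ := hw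
  -- A zero jump at one edge of the cycle would make all jumps of `f` vanish, so `f` would be
  -- constant, although `x ∈ K` and `y ∉ K`.
  intro h0
  rw [← sub_eq_zero, H.flow_iterate hs hf hv] at h0
  have hall : ∀ w, f (H.a w) = f (H.b w) := by
    intro w
    by_cases hw : w ∈ H.orbitEdges s v
    · obtain ⟨i, rfl⟩ := hw
      rw [← sub_eq_zero, H.flow_iterate hs hf hv, h0]
    · exact (hiff w).2 (hout w hw)
  have := H.const_of_a_eq_b hall x y
  rw [hmem, hmem, if_pos hx, if_neg (show y ∉ K from hxy)] at this
  exact one_ne_zero this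

section Orbit

variable {v : X}

open Classical in
theorem mem_orbitEdges_iff (hv : v ∈ periodicPts (H.pred s)) (w : W) : w ∈ H.orbitEdges s v ↔
    w ∈ (Finset.range (minimalPeriod (H.pred s) v)).image fun j => s ((H.pred s)^[j] v) := by
  simp only [Finset.mem_image, Finset.mem_range]
  constructor
  · rintro ⟨j, rfl⟩
    exact ⟨j % _, Nat.mod_lt _ (minimalPeriod_pos_of_mem_periodicPts hv),
      by rw [iterate_mod_minimalPeriod_eq]⟩
  · rintro ⟨j, -, rfl⟩
    exact ⟨j, rfl⟩

open Classical in
theorem sum_orbitEdges (hv : v ∈ periodicPts (H.pred s)) {A : Type*} [AddCommMonoid A] [Fintype W]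
    (hs : ∀ v, H.hd (s v) = v) (k : W → A) :
    (∑ w, if w ∈ H.orbitEdges s v then k w else 0) =
      ∑ j ∈ Finset.range (minimalPeriod (H.pred s) v), k (s ((H.pred s)^[j] v)) := by
  rw [← Finset.sum_image (f := k) (g := fun j => s ((H.pred s)^[j] v)), ← Finset.sum_filter]
  · congr 1
    ext w
    rw [← H.mem_orbitEdges_iff hv w]
    simp
  · intro i hi j hj h
    exact iterate_injOn_Iio_minimalPeriod (by simpa using hi) (by simpa using hj)
      (H.section_injective hs h)

end Orbit

/-! ### Existence of a wreath: the twisted Laplacian -/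

/-- There is a mod 2 cycle of the map that does not bound in the complement of the dual graph. -/
theorem exists_cocycle [Fintype W] [Fintype X] [Fintype U] : ∃ φ : W → ZMod 2,
    (∀ g : U → ZMod 2, ∑ w, φ w * (g (H.a w) + g (H.b w)) = 0) ∧
      ¬ ∃ p : X → ZMod 2, ∀ w, φ w = p (H.hd w) + p (H.tl w) := by
  by_contra! hcon
  let T : (U → ZMod 2) →ₗ[ZMod 2] (W → ZMod 2) :=
    LinearMap.funLeft _ _ H.a + LinearMap.funLeft _ _ H.b
  let B : (X → ZMod 2) →ₗ[ZMod 2] (W → ZMod 2) :=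
    LinearMap.funLeft _ _ H.hd + LinearMap.funLeft _ _ H.tl
  have hle : orthRange T ≤ LinearMap.range B := by
    intro φ hφ
    obtain ⟨p, hp⟩ := hcon φ hφ
    exact ⟨p, (funext hp).symm⟩
  have h1 := finrank_orthRange T
  have h2 := Submodule.finrank_mono hle
  have h3 := LinearMap.finrank_range_add_finrank_ker B
  rw [Module.finrank_fintype_fun_eq_card] at h3
  -- Constants lie in the kernel of `B`, so its range has dimension below `|X|`, while `orthRange T`
  -- has dimension at least `|W| - |U| = |X|`.
  have h4 : 0 < Module.finrank (ZMod 2) (LinearMap.ker B) := by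
    obtain ⟨w⟩ := H.nonempty
    refine Module.finrank_pos_iff_exists_ne_zero.2 ⟨⟨fun _ => 1, ?_⟩, fun h => ?_⟩
    · rw [LinearMap.mem_ker]
      ext w
      exact CharTwo.add_self_eq_zero (1 : ZMod 2)
    · exact one_ne_zero (congrFun (congrArg Subtype.val h) (H.hd w))
  have h5 := H.card_eq
  simp only [Nat.card_eq_fintype_card] at h5
  omega

theorem eq_zero_or_one_of_zmod_two (t : ZMod 2) : t = 0 ∨ t = 1 := by
  revert t; decide

/-- The sign given by an element of `ZMod 2`. -/
noncomputable def signOf (t : ZMod 2) : ℝ := if t = 0 then 1 else -1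

theorem signOf_mul_self (t : ZMod 2) : signOf t * signOf t = 1 := by
  unfold signOf; split_ifs <;> norm_num

theorem signOf_add (t u : ZMod 2) : signOf (t + u) = signOf t * signOf u := by
  rcases eq_zero_or_one_of_zmod_two t with rfl | rfl <;>
    rcases eq_zero_or_one_of_zmod_two u with rfl | rfl <;>
    simp [signOf, CharTwo.add_self_eq_zero]

theorem signOf_sum {ι : Type*} (S : Finset ι) (t : ι → ZMod 2) :
    signOf (∑ i ∈ S, t i) = ∏ i ∈ S, signOf (t i) := by
  classical
  induction S using Finset.induction_on with
  | empty => simp [signOf]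
  | insert i S hi ih => rw [Finset.sum_insert hi, Finset.prod_insert hi, signOf_add, ih]

open Classical in
/-- A row of the Laplacian twisted by the signs `φ`. -/
noncomputable def twistedRow (φ : W → ZMod 2) (w : W) : X → ℝ :=
  Pi.single (H.hd w) 1 - signOf (φ w) • Pi.single (H.tl w) 1

/-- The sum of squared defects is twice the given sum plus `∑ (f (tl w)² - f (hd w)²)`. The latter
is 0 because `ε` permutes the edges: every face has equal in- and outdegree. -/
theorem eq_sign_mul_of_harmonic [Fintype W] [Fintype X] (φ : W → ZMod 2) (f : X → ℝ)
    (hf : ∑ w, f (H.hd w) * (f (H.hd w) - signOf (φ w) * f (H.tl w)) = 0) (w : W) :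
    f (H.hd w) = signOf (φ w) * f (H.tl w) := by
  have h1 : ∑ w, f (H.tl w) * f (H.tl w) = ∑ w, f (H.hd w) * f (H.hd w) :=
    Equiv.sum_comp H.ε (fun w => f (H.hd w) * f (H.hd w))
  have h2 : ∑ w, (f (H.hd w) - signOf (φ w) * f (H.tl w)) *
      (f (H.hd w) - signOf (φ w) * f (H.tl w)) = 0 := by
    have : ∀ w, (f (H.hd w) - signOf (φ w) * f (H.tl w)) *
        (f (H.hd w) - signOf (φ w) * f (H.tl w)) =
        2 * (f (H.hd w) * (f (H.hd w) - signOf (φ w) * f (H.tl w))) +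
          (f (H.tl w) * f (H.tl w) - f (H.hd w) * f (H.hd w)) := by
      intro w
      linear_combination (f (H.tl w) * f (H.tl w)) * signOf_mul_self (φ w)
    simp only [this, Finset.sum_add_distrib, ← Finset.mul_sum, hf, Finset.sum_sub_distrib, h1]
    ring
  have := (Finset.sum_eq_zero_iff_of_nonneg (fun w _ => mul_self_nonneg _)).1 h2 w
    (Finset.mem_univ w)
  exact sub_eq_zero.1 (mul_self_eq_zero.1 this)

open Classical in
theorem exists_section_det_ne_zero [Fintype W] [Fintype X] {φ : W → ZMod 2}
    (hφ : ¬ ∃ p : X → ZMod 2, ∀ w, φ w = p (H.hd w) + p (H.tl w)) :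
    ∃ s : X → W, (∀ v, H.hd (s v) = v) ∧
      (Matrix.of fun v => H.twistedRow φ (s v)).det ≠ 0 := by
  have hdet : (Matrix.of fun v => ∑ w ∈ Finset.univ.filter (fun w => H.hd w = v),
      H.twistedRow φ w).det ≠ 0 := by
    intro h0
    obtain ⟨f, hf0, hf⟩ := Matrix.exists_mulVec_eq_zero_iff.2 h0
    have hrow : ∀ v, ∑ w ∈ Finset.univ.filter (fun w => H.hd w = v),
        (f (H.hd w) - signOf (φ w) * f (H.tl w)) = 0 := by
      intro v
      have := congrFun hf v
      simp only [Matrix.mulVec, Matrix.of_apply, Pi.zero_apply, sum_dotProduct] at this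
      rw [← this]
      refine Finset.sum_congr rfl fun w _ => ?_
      simp [twistedRow, sub_dotProduct]
    have hsum : ∑ w, f (H.hd w) * (f (H.hd w) - signOf (φ w) * f (H.tl w)) = 0 := by
      rw [← Finset.sum_fiberwise Finset.univ H.hd]
      refine Finset.sum_eq_zero fun v _ => ?_
      rw [← mul_zero (f v), ← hrow v, Finset.mul_sum]
      refine Finset.sum_congr rfl fun w hw => ?_
      rw [(Finset.mem_filter.1 hw).2]
    have hstep := H.eq_sign_mul_of_harmonic φ f hsum
    have habs : ∀ w, |f (H.hd w)| = |f (H.tl w)| := by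
      intro w
      rw [hstep w, abs_mul]
      unfold signOf
      split_ifs <;> simp
    have hconst := H.const_of_invariant (fun w => |f (H.hd w)|)
      (fun w => by rw [H.hd_δ]; exact (habs w).symm) (fun w => (habs w).symm)
    have hne : ∀ v, f v ≠ 0 := by
      intro v hv
      apply hf0
      ext u
      obtain ⟨w, rfl⟩ := H.hd_surjective v
      obtain ⟨w', rfl⟩ := H.hd_surjective u
      have h := hconst w' w
      simp only [hv, abs_zero, abs_eq_zero] at h
      exact h
    -- A kernel vector vanishes nowhere, and its signs exhibit `φ` as a coboundary.
    refine hφ ⟨fun v => if f v < 0 then 1 else 0, fun w => ?_⟩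
    have h1 := hstep w
    have h2 := hne (H.tl w)
    rcases eq_zero_or_one_of_zmod_two (φ w) with h | h
    · rw [h] at h1 ⊢
      simp only [signOf, if_true, one_mul] at h1
      simp only [h1]
      exact (CharTwo.add_self_eq_zero _).symm
    · rw [h] at h1 ⊢
      simp only [signOf, one_ne_zero, if_false, neg_mul, one_mul] at h1
      simp only [h1]
      rcases lt_or_gt_of_ne h2 with h3 | h3
      · simp [h3, not_lt.2 h3.le]
      · simp [h3, not_lt.2 h3.le]
  -- Multilinear expansion: choosing one summand in each row is choosing one incoming edge for each
  -- face.
  have hexp : (Matrix.of fun v => ∑ w ∈ Finset.univ.filter (fun w => H.hd w = v),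
      H.twistedRow φ w).det = ∑ s ∈ Fintype.piFinset
        (fun v => Finset.univ.filter (fun w => H.hd w = v)),
          (Matrix.of fun v => H.twistedRow φ (s v)).det :=
    MultilinearMap.map_sum_finset (Matrix.detRowAlternating (n := X) (R := ℝ)).toMultilinearMap
      (fun _ w => H.twistedRow φ w) _
  rw [hexp] at hdet
  obtain ⟨s, hs, hne⟩ := Finset.exists_ne_zero_of_sum_ne_zero hdet
  refine ⟨s, fun v => ?_, hne⟩
  simpa using Fintype.mem_piFinset.1 hs v

open Classical in
-- The rows along the cycle, weighted by the partial products of signs, telescope; the total sign 1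
-- closes the sum up to 0.
theorem det_eq_zero_of_sum_eq_zero [Fintype X] (hs : ∀ v, H.hd (s v) = v) {φ : W → ZMod 2}
    {v : X} (hv : v ∈ periodicPts (H.pred s))
    (h : ∑ j ∈ Finset.range (minimalPeriod (H.pred s) v), φ (s ((H.pred s)^[j] v)) = 0) :
    (Matrix.of fun v => H.twistedRow φ (s v)).det = 0 := by
  set m := minimalPeriod (H.pred s) v with hm
  have hpos : 0 < m := minimalPeriod_pos_of_mem_periodicPts hv
  set e : ℕ → X → ℝ := fun j => Pi.single ((H.pred s)^[j] v) 1 with he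
  set g : ℕ → ℝ := fun j => ∏ i ∈ Finset.range j, signOf (φ (s ((H.pred s)^[i] v))) with hg
  refine Matrix.exists_vecMul_eq_zero_iff.1 ⟨∑ j ∈ Finset.range m, g j • e j, ?_, ?_⟩
  · intro h0
    have := congrFun h0 v
    rw [Finset.sum_apply, Finset.sum_eq_single 0] at this
    · simp [g, e] at this
    · intro j hj hj0
      have : v ≠ (H.pred s)^[j] v := fun h' =>
        not_isPeriodicPt_of_pos_of_lt_minimalPeriod hj0 (Finset.mem_range.1 hj) h'.symm
      simp [e, this]
    · simp [hpos.ne']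
  · have hterm : ∀ j, Matrix.vecMul (g j • e j) (Matrix.of fun v => H.twistedRow φ (s v)) =
        g j • e j - g (j + 1) • e (j + 1) := by
      intro j
      rw [Matrix.smul_vecMul, Matrix.single_one_vecMul]
      change g j • H.twistedRow φ (s ((H.pred s)^[j] v)) = _
      simp only [twistedRow, hs]
      rw [smul_sub, smul_smul, hg]
      simp only [Finset.prod_range_succ, e, iterate_succ_apply', pred]
    rw [Matrix.sum_vecMul, Finset.sum_congr rfl (fun j _ => hterm j), Finset.sum_range_sub']
    have hgm : g m = 1 := by
      rw [hg]
      simp only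
      rw [← signOf_sum, h]
      simp [signOf]
    rw [hgm]
    simp only [g, e, Finset.range_zero, Finset.prod_empty, iterate_zero, id_eq]
    rw [show (H.pred s)^[m] v = v from iterate_minimalPeriod, sub_self]

/-- There is a choice of incoming edges all of whose cycles are nonseparating. -/
theorem exists_section_connected [Finite W] [Finite X] [Finite U] :
    ∃ s : X → W, (∀ v, H.hd (s v) = v) ∧
      ∀ v ∈ periodicPts (H.pred s), (H.cut (H.orbitEdges s v)).Connected := by
  classical
  have := Fintype.ofFinite W
  have := Fintype.ofFinite X
  have := Fintype.ofFinite U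
  obtain ⟨φ, hφ, hnot⟩ := H.exists_cocycle
  obtain ⟨s, hs, hdet⟩ := H.exists_section_det_ne_zero hnot
  refine ⟨s, hs, fun v hv => ?_⟩
  by_contra hcon
  obtain ⟨K, hK⟩ := H.exists_side hs hv hcon
  apply hdet
  convert H.det_eq_zero_of_sum_eq_zero hs hv (φ := φ) ?_
  -- Modulo 2, the cycle is the coboundary of the indicator of `K`, to which `φ` is orthogonal.
  rw [← H.sum_orbitEdges hv hs, ← hφ (K.indicator 1)]
  refine Finset.sum_congr rfl fun w _ => ?_
  rw [Set.indicator_apply, Set.indicator_apply]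
  have := hK w
  by_cases h1 : H.a w ∈ K <;> by_cases h2 : H.b w ∈ K <;>
    simp_all [CharTwo.add_self_eq_zero]

/-! ### Comparing the cycles of the wreath with the components of the cut graph -/

/-- The functions on the vertices that are constant along the edges outside `S`. -/
def cutFun (S : Set W) : Submodule ℝ (U → ℝ) where
  carrier := {f | ∀ w, w ∉ S → f (H.a w) = f (H.b w)}
  add_mem' := by
    intro f g hf hg w hw
    simp only [Pi.add_apply, hf w hw, hg w hw]
  zero_mem' := fun _ _ => rfl
  smul_mem' := by
    intro r f hf w hw
    simp only [Pi.smul_apply, hf w hw]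

/-- The real cycles of the map that avoid the edges in `S`. -/
def flows [Fintype W] (S : Set W) : Submodule ℝ (W → ℝ) where
  carrier := {φ | (∀ w ∈ S, φ w = 0) ∧ ∀ g : U → ℝ, ∑ w, φ w * (g (H.a w) - g (H.b w)) = 0}
  add_mem' := by
    rintro φ ψ ⟨hφ, hφ'⟩ ⟨hψ, hψ'⟩
    refine ⟨fun w hw => by simp [hφ w hw, hψ w hw], fun g => ?_⟩
    simp only [Pi.add_apply, add_mul, Finset.sum_add_distrib, hφ', hψ', add_zero]
  zero_mem' := ⟨fun _ _ => rfl, by simp⟩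
  smul_mem' := by
    rintro r φ ⟨hφ, hφ'⟩
    refine ⟨fun w hw => by simp [hφ w hw], fun g => ?_⟩
    simp only [Pi.smul_apply, smul_eq_mul, mul_assoc, ← Finset.mul_sum, hφ', mul_zero]

/-- The functions on the faces that are invariant under `pred`. -/
def invFun (s : X → W) : Submodule ℝ (X → ℝ) where
  carrier := {p | ∀ v, p (H.pred s v) = p v}
  add_mem' := by
    intro p q hp hq v
    simp only [Pi.add_apply, hp v, hq v]
  zero_mem' := fun _ => rfl
  smul_mem' := by
    intro r p hp v
    simp only [Pi.smul_apply, hp v]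

/-- Pairs of functions on the corners of the map at the first and the second endpoints of the
edges that are locally constant on the boundary of the surface cut along the dual edges in `S`. -/
def sideFun (S : Set W) : Submodule ℝ ((W → ℝ) × (W → ℝ)) where
  carrier := {L | ∀ w, (w ∉ S → L.1 w = L.2 w ∧ L.1 (H.ε w) = L.2 (H.δ w)) ∧
    (w ∈ S → L.1 w = L.1 (H.ε w) ∧ L.2 w = L.2 (H.δ w))}
  add_mem' := by
    intro L M hL hM w
    refine ⟨fun hw => ?_, fun hw => ?_⟩
    · obtain ⟨h1, h2⟩ := (hL w).1 hw
      obtain ⟨h3, h4⟩ := (hM w).1 hw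
      simp [h1, h2, h3, h4]
    · obtain ⟨h1, h2⟩ := (hL w).2 hw
      obtain ⟨h3, h4⟩ := (hM w).2 hw
      constructor
      · change L.1 w + M.1 w = L.1 (H.ε w) + M.1 (H.ε w)
        rw [h1, h3]
      · change L.2 w + M.2 w = L.2 (H.δ w) + M.2 (H.δ w)
        rw [h2, h4]
  zero_mem' := fun w => ⟨fun _ => ⟨rfl, rfl⟩, fun _ => ⟨rfl, rfl⟩⟩
  smul_mem' := by
    intro r L hL w
    refine ⟨fun hw => ?_, fun hw => ?_⟩
    · obtain ⟨h1, h2⟩ := (hL w).1 hw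
      simp [h1, h2]
    · obtain ⟨h1, h2⟩ := (hL w).2 hw
      constructor
      · change r * L.1 w = r * L.1 (H.ε w)
        rw [h1]
      · change r * L.2 w = r * L.2 (H.δ w)
        rw [h2]

/-- The differences of `D` along `ε` and of `E` along `δ` agree at every edge and vanish on `S`.
Around each vertex they sum to 0. -/
theorem sub_comp_mem_flows [Fintype W] {S : Set W} {D E : W → ℝ} (h : (D, E) ∈ H.sideFun S) :
    (fun w => D w - D (H.ε w)) ∈ H.flows S := by
  refine ⟨fun w hw => sub_eq_zero.2 ((h w).2 hw).1, fun g => ?_⟩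
  have hDE : ∀ w, D w - D (H.ε w) = E w - E (H.δ w) := by
    intro w
    by_cases hw : w ∈ S
    · obtain ⟨h1, h2⟩ := (h w).2 hw
      exact (sub_eq_zero.2 h1).trans (sub_eq_zero.2 h2).symm
    · obtain ⟨h1, h2⟩ := (h w).1 hw
      exact congrArg₂ _ h1 h2
  have : ∀ w, (D w - D (H.ε w)) * (g (H.a w) - g (H.b w)) =
      (D w * g (H.a w) - D (H.ε w) * g (H.a w)) - (E w * g (H.b w) - E (H.δ w) * g (H.b w)) := by
    intro w
    linear_combination (- g (H.b w)) * hDE w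
  simp only [this, Finset.sum_sub_distrib, H.sum_ε_comp, H.sum_δ_comp, sub_self]

/-- Corner functions with vanishing jumps across the edges come from the vertices. -/
theorem exists_of_sub_comp_eq_zero {S : Set W} {D E : W → ℝ} (h : (D, E) ∈ H.sideFun S)
    (h0 : ∀ w, D w - D (H.ε w) = 0) :
    ∃ f ∈ H.cutFun S, (∀ w, f (H.a w) = D w) ∧ ∀ w, f (H.b w) = E w := by
  have hD : ∀ w, D (H.ε w) = D w := fun w => (sub_eq_zero.1 (h0 w)).symm
  obtain ⟨f, hfa, hfb⟩ := H.lift_U D E hD (fun w => by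
    by_cases hw : w ∈ S
    · exact ((h w).2 hw).2.symm
    · obtain ⟨h1, h2⟩ := (h w).1 hw
      exact h2.symm.trans ((hD w).trans h1))
  refine ⟨f, fun w hw => ?_, hfa, hfb⟩
  rw [hfa, hfb]
  exact ((h w).1 hw).1

open Classical in
-- Both spaces are kernels, on the left and on the right, of one matrix, which is square because
-- `|W| = |X| + |U|`. Its columns in `X` force flows to vanish on the chosen edges.
theorem finrank_flows [Fintype W] [Fintype X] [Fintype U] (hs : ∀ v, H.hd (s v) = v) :
    Module.finrank ℝ (H.flows (Set.range s)) = Module.finrank ℝ (H.cutFun (Set.range s)) := by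
  let T : (X ⊕ U → ℝ) →ₗ[ℝ] (W → ℝ) :=
    { toFun := fun y w => if w ∈ Set.range s then y (Sum.inl (H.hd w))
        else y (Sum.inr (H.a w)) - y (Sum.inr (H.b w))
      map_add' := by
        intro y z
        ext w
        simp only [Pi.add_apply]
        split_ifs <;> ring
      map_smul' := by
        intro r y
        ext w
        simp only [Pi.smul_apply, smul_eq_mul, RingHom.id_apply]
        split_ifs <;> ring }
  have hT : ∀ y w, T y w = if w ∈ Set.range s then y (Sum.inl (H.hd w))
        else y (Sum.inr (H.a w)) - y (Sum.inr (H.b w)) := fun _ _ => rfl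
  have horth : orthRange T = H.flows (Set.range s) := by
    ext φ
    constructor
    · intro hφ
      have h0 : ∀ w ∈ Set.range s, φ w = 0 := by
        rintro _ ⟨v, rfl⟩
        have := hφ (Pi.single (Sum.inl v) 1)
        rw [Finset.sum_eq_single (s v)] at this
        · simpa [hT, hs] using this
        · intro w _ hw
          rw [hT]
          split_ifs with h
          · obtain ⟨u, rfl⟩ := h
            have : u ≠ v := fun h => hw (by rw [h])
            simp [hs, this]
          · simp
        · simp
      refine ⟨h0, fun g => ?_⟩
      rw [← hφ (Sum.elim 0 g)]
      refine Finset.sum_congr rfl fun w _ => ?_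
      rw [hT]
      split_ifs with h
      · rw [h0 w h, zero_mul, zero_mul]
      · rfl
    · rintro ⟨h0, h1⟩ y
      rw [← h1 (fun x => y (Sum.inr x))]
      refine Finset.sum_congr rfl fun w _ => ?_
      rw [hT]
      split_ifs with h
      · rw [h0 w h, zero_mul, zero_mul]
      · rfl
  let e : LinearMap.ker T ≃ₗ[ℝ] H.cutFun (Set.range s) :=
    { toFun := fun y => ⟨fun x => y.1 (Sum.inr x), fun w hw => by
        have := congrFun (LinearMap.mem_ker.1 y.2) w
        rw [hT, if_neg hw] at this
        exact sub_eq_zero.1 this⟩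
      invFun := fun g => ⟨Sum.elim 0 g.1, by
        rw [LinearMap.mem_ker]
        ext w
        rw [hT]
        split_ifs with h
        · rfl
        · exact sub_eq_zero.2 (g.2 w h)⟩
      left_inv := by
        intro y
        ext x
        rcases x with v | x
        · have := congrFun (LinearMap.mem_ker.1 y.2) (s v)
          rw [hT, if_pos ⟨v, rfl⟩, hs] at this
          exact this.symm
        · rfl
      right_inv := fun _ => rfl
      map_add' := fun _ _ => rfl
      map_smul' := fun _ _ => rfl }
  have h1 := finrank_orthRange T
  have h2 := H.card_eq
  rw [horth, e.finrank_eq, Fintype.card_sum] at h1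
  simp only [Nat.card_eq_fintype_card] at h2
  omega

open Classical in
/-- There is a corner function that jumps by `1` exactly across the cycles of `S`. -/
theorem exists_left_side [Finite W] [Finite X] (hs : ∀ v, H.hd (s v) = v) :
    ∃ D E : W → ℝ, (D, E) ∈ H.sideFun (Set.range s) ∧
      ∀ v ∈ periodicPts (H.pred s), D (s v) - E (s v) = 1 := by
  have := Fintype.ofFinite W
  have := Fintype.ofFinite X
  set ζ : W → ℝ := fun w => if w ∈ Set.range s ∧ H.hd w ∈ periodicPts (H.pred s) then 1 else 0
    with hζ
  have hζs : ∀ v, ζ (s v) = if v ∈ periodicPts (H.pred s) then 1 else 0 := by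
    intro v
    simp [hζ, hs]
  have hζ0 : ∀ w, w ∉ Set.range s → ζ w = 0 := fun w hw => if_neg fun h => hw h.1
  have hsum : ∀ k : W → ℝ, ∑ w, ζ w * k w =
      ∑ v, if v ∈ periodicPts (H.pred s) then k (s v) else 0 := by
    intro k
    rw [H.sum_section hs _ fun w hw => by rw [hζ0 w hw, zero_mul]]
    simp only [hζs, ite_mul, one_mul, zero_mul]
  -- Turning around a face, `u` changes by 1 at each cycle edge met, with opposite signs for
  -- incoming and outgoing ones. It is single-valued because a face on a cycle has exactly one of
  -- each.
  obtain ⟨u, hu⟩ := exists_sub_eq_of_orthogonal (H.δ * H.ε⁻¹)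
    (fun w => ζ ((H.δ * H.ε⁻¹) w) - ζ (H.ε⁻¹ w)) (by
      intro F hF
      have hF' : ∀ w, F (H.δ w) = F (H.ε w) := by
        intro w
        have := hF (H.ε w)
        simpa using this
      obtain ⟨f, hf⟩ := H.lift_X F hF'
      have h1 : ∑ w, F w * ζ ((H.δ * H.ε⁻¹) w) = ∑ w, ζ w * F w := by
        rw [← Equiv.sum_comp (H.δ * H.ε⁻¹) (fun w => ζ w * F w)]
        simp only [hF, mul_comm]
      have h2 : ∑ w, F w * ζ (H.ε⁻¹ w) = ∑ w, ζ w * F (H.ε w) := by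
        rw [← Equiv.sum_comp (H.ε⁻¹) (fun w => ζ w * F (H.ε w))]
        simp [mul_comm]
      simp only [mul_sub, Finset.sum_sub_distrib]
      rw [h1, h2, hsum, hsum]
      simp only [← hf, hs]
      exact sub_eq_zero.2 (sum_periodicPts_comp (H.pred s) f).symm)
  have hu' : ∀ w, u (H.δ w) - u (H.ε w) = ζ (H.δ w) - ζ w := by
    intro w
    have := hu (H.ε w)
    simpa using this
  -- The values of `u` on the same side of the two cycle edges at a face agree. Summing the changes
  -- of `u²` around that face gives `2u - 1` at the incoming and at the outgoing edge, and these
  -- must be equal.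
  have hlocal : ∀ v ∈ periodicPts (H.pred s), u (H.ε (s v)) = u (s (H.pred s v)) := by
    intro v hv
    have hpv := (bijOn_periodicPts (H.pred s)).mapsTo hv
    have key := H.sum_hd_mul_sub (Pi.single (H.pred s v) 1) (fun w => u w * u w)
      (fun w => (u w - ζ w) * (u w - ζ w))
    have h1 : ∀ w, (Pi.single (H.pred s v) 1 : X → ℝ) (H.hd w) *
        (u w * u w - (u w - ζ w) * (u w - ζ w)) =
        ζ w * ((Pi.single (H.pred s v) 1 : X → ℝ) (H.hd w) * (2 * u w - ζ w)) := by
      intro w; ring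
    have h2 : ∀ w, (Pi.single (H.pred s v) 1 : X → ℝ) (H.tl w) *
        (u (H.ε w) * u (H.ε w) - (u (H.δ w) - ζ (H.δ w)) * (u (H.δ w) - ζ (H.δ w))) =
        ζ w * ((Pi.single (H.pred s v) 1 : X → ℝ) (H.tl w) * (2 * u (H.ε w) - ζ w)) := by
      intro w
      have : u (H.δ w) - ζ (H.δ w) = u (H.ε w) - ζ w := by linarith [hu' w]
      rw [this]
      ring
    simp only [h1, h2, hsum] at key
    rw [Finset.sum_eq_single (H.pred s v), Finset.sum_eq_single v] at key
    · simp only [if_pos hv, if_pos hpv, hs, hζs] at key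
      rw [show H.tl (s v) = H.pred s v from rfl] at key
      simp only [Pi.single_eq_same] at key
      linarith
    · intro t _ ht
      split_ifs with h
      · have : H.tl (s t) ≠ H.pred s v := fun h' => ht (periodicPts_injOn h hv h')
        simp [Pi.single_eq_of_ne this]
      · rfl
    · simp
    · intro t _ ht
      rw [hs, Pi.single_eq_of_ne ht, zero_mul, ite_self]
    · simp
  obtain ⟨M, hM⟩ := exists_iterate_mem_periodicPts (H.pred s)
  set h : X → ℝ := fun v => u (H.ε (s v)) - u (s v) with hh
  -- This solves `p - p ∘ pred = h`: after `M` steps the orbit is on a cycle, where by `hlocal` the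
  -- function `-(u ∘ s)` is a solution.
  set p : X → ℝ := fun v => ∑ j ∈ Finset.range M, h ((H.pred s)^[j] v) -
    u (s ((H.pred s)^[M] v)) with hp
  have hpv : ∀ v, p v - p (H.pred s v) = h v := by
    intro v
    have e1 := Finset.sum_range_succ (fun j => h ((H.pred s)^[j] v)) M
    have e2 := Finset.sum_range_succ' (fun j => h ((H.pred s)^[j] v)) M
    have e3 : h ((H.pred s)^[M] v) = u (s ((H.pred s)^[M] (H.pred s v))) -
        u (s ((H.pred s)^[M] v)) := by
      rw [hh]
      simp only
      rw [hlocal _ (hM v), ← iterate_succ_apply' (H.pred s), iterate_succ_apply]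
    simp only [iterate_succ_apply, iterate_zero, id_eq] at e1 e2
    simp only [hp]
    linarith
  refine ⟨fun w => u w + p (H.hd w), fun w => u w - ζ w + p (H.hd w), fun w => ⟨fun hw => ?_, ?_⟩,
    fun v hv => ?_⟩
  · simp only [H.hd_δ, hζ0 w hw]
    have := hu' w
    rw [hζ0 w hw] at this
    constructor <;> linarith
  · rintro ⟨v, rfl⟩
    simp only [H.hd_δ, hs]
    have h1 := hpv v
    have h2 := hu' (s v)
    have h3 : p (H.hd (H.ε (s v))) = p (H.pred s v) := rfl
    simp only [hh] at h1
    rw [h3]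
    constructor <;> linarith
  · simp only [hζs, if_pos hv]
    ring

theorem invFun_iterate {p : X → ℝ} (hp : p ∈ H.invFun s) (j : ℕ) (v : X) :
    p ((H.pred s)^[j] v) = p v := by
  induction j with
  | zero => rfl
  | succ j ih => rw [iterate_succ_apply', hp, ih]

/-- Two invariant functions, one weighting the side function `(D, E)` and one added to it, inject
into `sideFun`. Jumps map `sideFun` to `flows` with kernel coming from `cutFun`, so `2k ≤ dim flows
+ dim cutFun = 2 dim cutFun`. -/
theorem finrank_invFun_le [Fintype W] [Fintype X] [Fintype U] (hs : ∀ v, H.hd (s v) = v) :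
    Module.finrank ℝ (H.invFun s) ≤ Module.finrank ℝ (H.cutFun (Set.range s)) := by
  obtain ⟨D, E, hL, hjump⟩ := H.exists_left_side hs
  let I : (H.invFun s × H.invFun s) →ₗ[ℝ] (W → ℝ) × (W → ℝ) :=
    { toFun := fun q => (fun w => q.1.1 (H.hd w) * D w + q.2.1 (H.hd w),
        fun w => q.1.1 (H.hd w) * E w + q.2.1 (H.hd w))
      map_add' := by
        intro q r
        ext w
        · change (q.1.1 _ + r.1.1 _) * _ + (q.2.1 _ + r.2.1 _) = _ + _ + (_ + _)
          ring
        · change (q.1.1 _ + r.1.1 _) * _ + (q.2.1 _ + r.2.1 _) = _ + _ + (_ + _)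
          ring
      map_smul' := by
        intro r q
        ext w
        · change (r * q.1.1 _) * _ + (r * q.2.1 _) = r * (_ + _)
          ring
        · change (r * q.1.1 _) * _ + (r * q.2.1 _) = r * (_ + _)
          ring }
  have hI : Injective I := by
    rw [← LinearMap.ker_eq_bot, LinearMap.ker_eq_bot']
    rintro ⟨⟨p, hp⟩, ⟨q, hq⟩⟩ h0
    obtain ⟨M, hM⟩ := exists_iterate_mem_periodicPts (H.pred s)
    have h1 : ∀ w, p (H.hd w) * D w + q (H.hd w) = 0 := congrFun (congrArg Prod.fst h0)
    have h2 : ∀ w, p (H.hd w) * E w + q (H.hd w) = 0 := congrFun (congrArg Prod.snd h0)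
    have hp0 : ∀ v, p v = 0 := by
      intro v
      rw [← H.invFun_iterate hp M]
      have e1 := h1 (s ((H.pred s)^[M] v))
      have e2 := h2 (s ((H.pred s)^[M] v))
      have e3 := hjump _ (hM v)
      rw [hs] at e1 e2
      linear_combination e1 - e2 - p ((H.pred s)^[M] v) * e3
    have hq0 : ∀ v, q v = 0 := by
      intro v
      have := h1 (s v)
      rw [hs, hp0] at this
      linarith
    ext v
    · exact hp0 v
    · exact hq0 v
  have hrange : LinearMap.range I ≤ H.sideFun (Set.range s) := by
    rintro _ ⟨⟨⟨p, hp⟩, ⟨q, hq⟩⟩, rfl⟩ w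
    change (w ∉ Set.range s → p (H.hd w) * D w + q (H.hd w) = p (H.hd w) * E w + q (H.hd w) ∧
        p (H.hd (H.ε w)) * D (H.ε w) + q (H.hd (H.ε w)) =
          p (H.hd (H.δ w)) * E (H.δ w) + q (H.hd (H.δ w))) ∧
      (w ∈ Set.range s → p (H.hd w) * D w + q (H.hd w) =
          p (H.hd (H.ε w)) * D (H.ε w) + q (H.hd (H.ε w)) ∧
        p (H.hd w) * E w + q (H.hd w) = p (H.hd (H.δ w)) * E (H.δ w) + q (H.hd (H.δ w)))
    simp only [H.hd_δ]
    refine ⟨fun hw => ?_, ?_⟩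
    · obtain ⟨h1, h2⟩ := (hL w).1 hw
      simp only at h1 h2
      rw [h1, h2]
      exact ⟨rfl, rfl⟩
    · rintro ⟨v, rfl⟩
      obtain ⟨h1, h2⟩ := (hL (s v)).2 ⟨v, rfl⟩
      simp only at h1 h2
      rw [hs, show H.hd (H.ε (s v)) = H.pred s v from rfl, hp, hq, ← h1, ← h2]
      exact ⟨rfl, rfl⟩
  let Λ : (W → ℝ) × (W → ℝ) →ₗ[ℝ] (W → ℝ) :=
    LinearMap.fst ℝ _ _ - (LinearMap.funLeft ℝ ℝ H.ε).comp (LinearMap.fst ℝ _ _)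
  let J : (U → ℝ) →ₗ[ℝ] (W → ℝ) × (W → ℝ) :=
    (LinearMap.funLeft ℝ ℝ H.a).prod (LinearMap.funLeft ℝ ℝ H.b)
  have h1 := LinearMap.finrank_range_of_inj hI
  have h2 := Submodule.finrank_mono hrange
  have h3 := LinearMap.finrank_range_add_finrank_ker (Λ.domRestrict (H.sideFun (Set.range s)))
  have h4 : LinearMap.range (Λ.domRestrict (H.sideFun (Set.range s))) ≤
      H.flows (Set.range s) := by
    rintro _ ⟨⟨⟨D, E⟩, h⟩, rfl⟩
    exact H.sub_comp_mem_flows h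
  have h5 := Submodule.finrank_mono h4
  have h6 : (LinearMap.ker (Λ.domRestrict (H.sideFun (Set.range s)))).map
      (H.sideFun (Set.range s)).subtype ≤ (H.cutFun (Set.range s)).map J := by
    rintro _ ⟨⟨⟨D, E⟩, h⟩, h0, rfl⟩
    obtain ⟨f, hf, hfa, hfb⟩ := H.exists_of_sub_comp_eq_zero h (congrFun (LinearMap.mem_ker.1 h0))
    refine ⟨f, hf, ?_⟩
    ext w
    · exact hfa w
    · exact hfb w
  have h7 := Submodule.finrank_mono h6
  have h8 := Submodule.finrank_map_le J (H.cutFun (Set.range s))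
  rw [Submodule.finrank_map_subtype_eq] at h7
  rw [Module.finrank_prod] at h1
  have h9 := H.finrank_flows hs
  omega

/-- The faces from which the orbit of a given face is reached. -/
def basin (s : X → W) (v : X) : Set X := {u | ∃ i j : ℕ, (H.pred s)^[i] u = (H.pred s)^[j] v}

theorem mem_basin_self (v : X) : v ∈ H.basin s v := ⟨0, 0, rfl⟩

theorem indicator_basin_mem (v : X) : (H.basin s v).indicator 1 ∈ H.invFun s := by
  intro u
  have : H.pred s u ∈ H.basin s v ↔ u ∈ H.basin s v := by
    constructor
    · rintro ⟨i, j, h⟩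
      exact ⟨i + 1, j, h⟩
    · rintro ⟨i, j, h⟩
      refine ⟨i, j + 1, ?_⟩
      rw [iterate_succ_apply', ← h, ← iterate_succ_apply' (H.pred s), iterate_succ_apply]
  classical
  simp only [Set.indicator_apply, this, Pi.one_apply]

theorem exists_eq_iterate_of_mem_basin {u v : X} (hu : u ∈ periodicPts (H.pred s))
    (h : u ∈ H.basin s v) : ∃ j : ℕ, u = (H.pred s)^[j] v := by
  obtain ⟨i, j, h⟩ := h
  obtain ⟨n, hn, hper⟩ := hu
  refine ⟨n * i - i + j, ?_⟩
  rw [iterate_add_apply, ← h, ← iterate_add_apply, Nat.sub_add_cancel (Nat.le_mul_of_pos_left i hn)]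
  exact (hper.mul_const i).symm

/-- The jumps across the cycles map `cutFun` to `invFun`. The kernel consists of constants, and the
image is proper because no single cycle bounds. -/
theorem finrank_cutFun_le [Finite W] [Finite X] [Finite U] (hs : ∀ v, H.hd (s v) = v)
    (hC : ∀ v ∈ periodicPts (H.pred s), ¬ H.IsBoundary (H.orbitEdges s v)) :
    Module.finrank ℝ (H.cutFun (Set.range s)) ≤ Module.finrank ℝ (H.invFun s) := by
  obtain ⟨M, hM⟩ := exists_iterate_mem_periodicPts (H.pred s)
  let Ψ : H.cutFun (Set.range s) →ₗ[ℝ] (X → ℝ) :=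
    { toFun := fun f v => f.1 (H.a (s ((H.pred s)^[M] v))) - f.1 (H.b (s ((H.pred s)^[M] v)))
      map_add' := by
        intro f g
        ext v
        change (f.1 _ + g.1 _) - (f.1 _ + g.1 _) = (_ - _) + (_ - _)
        ring
      map_smul' := by
        intro r f
        ext v
        change r * f.1 _ - r * f.1 _ = r * (_ - _)
        ring }
  have hΨ : ∀ (f : H.cutFun (Set.range s)) v, Ψ f v =
    f.1 (H.a (s ((H.pred s)^[M] v))) - f.1 (H.b (s ((H.pred s)^[M] v))) := fun _ _ => rfl
  obtain ⟨w₀⟩ := H.nonempty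
  have hlt : LinearMap.range Ψ < H.invFun s := by
    refine lt_of_le_of_ne ?_ fun heq => ?_
    · rintro _ ⟨f, rfl⟩ v
      rw [hΨ, hΨ, ← iterate_succ_apply, iterate_succ_apply', H.flow_pred hs f.2 (hM v)]
    -- If the map were onto, some `f` would jump by 1 across the cycle of `v` and across no other,
    -- so that this cycle would bound.
    · set v := (H.pred s)^[M] (H.hd w₀) with hv
      have hmem := H.indicator_basin_mem (s := s) v
      obtain ⟨f, hf⟩ := heq.symm ▸ hmem
      have key : ∀ u ∈ periodicPts (H.pred s), f.1 (H.a (s u)) - f.1 (H.b (s u)) =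
          (H.basin s v).indicator 1 u := by
        intro u hu
        obtain ⟨t, -, rfl⟩ := exists_periodicPts_iterate_eq M hu
        rw [H.invFun_iterate hmem, ← hf]
        rfl
      refine hC v (hM _) (H.isBoundary_orbitEdges hs f.2 (hM _) ?_ ?_)
      · rw [← sub_ne_zero, key v (hM _), Set.indicator_of_mem (H.mem_basin_self v)]
        exact one_ne_zero
      · intro u hu hne
        refine H.exists_eq_iterate_of_mem_basin hu ?_
        by_contra hnot
        rw [← sub_ne_zero, key u hu, Set.indicator_of_notMem hnot] at hne
        exact hne rfl
  have h1 := Submodule.finrank_lt_finrank_of_lt hlt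
  have h2 := LinearMap.finrank_range_add_finrank_ker Ψ
  have h3 : Module.finrank ℝ (LinearMap.ker Ψ) ≤ 1 := by
    have hle : (LinearMap.ker Ψ).map (H.cutFun (Set.range s)).subtype ≤ Submodule.span ℝ {1} := by
      rintro _ ⟨f, hf, rfl⟩
      have hab : ∀ w, f.1 (H.a w) = f.1 (H.b w) := by
        intro w
        by_cases hw : w ∈ Set.range s
        · obtain ⟨v, rfl⟩ := hw
          by_cases hv : v ∈ periodicPts (H.pred s)
          · obtain ⟨t, -, rfl⟩ := exists_periodicPts_iterate_eq M hv
            exact sub_eq_zero.1 (congrFun (LinearMap.mem_ker.1 hf) t)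
          · exact H.flow_eq_zero hs f.2 hv
        · exact f.2 w hw
      refine Submodule.mem_span_singleton.2 ⟨f.1 (H.a w₀), ?_⟩
      ext x
      simpa using H.const_of_a_eq_b hab (H.a w₀) x
    have := Submodule.finrank_mono hle
    rw [Submodule.finrank_map_subtype_eq] at this
    refine this.trans ?_
    have : Nonempty U := ⟨H.a w₀⟩
    rw [finrank_span_singleton (one_ne_zero)]
  omega

/-- Every component of the complement of the chosen edges carries a nonzero real cycle. -/
theorem exists_flow_of_component [Fintype W] [Finite X] [Finite U] (hs : ∀ v, H.hd (s v) = v)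
    (hC : ∀ v ∈ periodicPts (H.pred s), ¬ H.IsBoundary (H.orbitEdges s v)) {K : Set U}
    (hK : ∀ w, w ∉ Set.range s → (H.a w ∈ K ↔ H.b w ∈ K)) (hne : K.Nonempty)
    (hconst : ∀ f ∈ H.cutFun (Set.range s), ∀ x ∈ K, ∀ y ∈ K, f x = f y) :
    ∃ φ ∈ H.flows (Set.range s), (∀ w, H.a w ∉ K → φ w = 0) ∧ ∃ w, φ w ≠ 0 := by
  classical
  have := Fintype.ofFinite X
  have := Fintype.ofFinite U
  by_contra! hcon
  -- Restricting `p` to the corners in `K` gives a side function whose jumps form a flow on `K`,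
  -- hence vanish; so `p` takes one value on all faces touching `K`.
  have step : ∀ p ∈ H.invFun s, ∃ c, ∀ w, (H.a w ∈ K ∨ H.b w ∈ K) → p (H.hd w) = c := by
    intro p hp
    have hL : (((fun w => if H.a w ∈ K then p (H.hd w) else 0),
        (fun w => if H.b w ∈ K then p (H.hd w) else 0)) : (W → ℝ) × (W → ℝ)) ∈
        H.sideFun (Set.range s) := by
      intro w
      simp only [H.a_ε, H.b_δ, H.hd_δ]
      refine ⟨fun hw => ?_, ?_⟩
      · simp only [hK w hw, and_self]
      · rintro ⟨v, rfl⟩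
        rw [hs, show H.hd (H.ε (s v)) = H.pred s v from rfl, hp]
        exact ⟨rfl, rfl⟩
    obtain ⟨f, hf, hfa, hfb⟩ := H.exists_of_sub_comp_eq_zero hL
      (hcon _ (H.sub_comp_mem_flows hL) (fun w hw => by simp only [H.a_ε, if_neg hw, sub_self]))
    obtain ⟨x, hx⟩ := hne
    refine ⟨f x, ?_⟩
    rintro w (hw | hw)
    · rw [← hconst f hf _ hw _ hx, hfa, if_pos hw]
    · rw [← hconst f hf _ hw _ hx, hfb, if_pos hw]
  set f : U → ℝ := K.indicator 1 with hfdef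
  have hmem : ∀ z, f z = if z ∈ K then 1 else 0 := fun z => by simp [hfdef, Set.indicator_apply]
  have hf : ∀ w, w ∉ Set.range s → f (H.a w) = f (H.b w) := by
    intro w hw
    simp only [hmem, hK w hw]
  have hor : ∀ w, f (H.a w) ≠ f (H.b w) → H.a w ∈ K ∨ H.b w ∈ K := by
    intro w hw
    by_contra! h
    exact hw (by rw [hmem, hmem, if_neg h.1, if_neg h.2])
  -- Either `K` is all of `U` and there are no flows at all, against `finrank_flows`; or the
  -- boundary of `K` meets a cycle, which by `step` is the only one it meets and thus bounds.
  by_cases hall : ∀ w, f (H.a w) = f (H.b w)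
  · obtain ⟨x, hx⟩ := hne
    have huniv : ∀ y, y ∈ K := by
      intro y
      by_contra hy
      have := H.const_of_a_eq_b hall x y
      rw [hmem, hmem, if_pos hx, if_neg hy] at this
      exact one_ne_zero this
    have hbot : H.flows (Set.range s) = ⊥ := by
      rw [Submodule.eq_bot_iff]
      intro φ hφ
      ext w
      exact hcon φ hφ (fun w hw => absurd (huniv _) hw) w
    have h0 := H.finrank_flows hs
    rw [hbot, finrank_bot] at h0
    have h1 := Submodule.finrank_eq_zero.1 h0.symm
    have h2 : f ∈ H.cutFun (Set.range s) := hf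
    rw [h1, Submodule.mem_bot] at h2
    have := congrFun h2 x
    rw [hmem, if_pos hx] at this
    exact one_ne_zero this
  · push Not at hall
    obtain ⟨w₀, hw₀⟩ := hall
    have hr : w₀ ∈ Set.range s := by
      by_contra h
      exact hw₀ (hf w₀ h)
    obtain ⟨v, rfl⟩ := hr
    have hv : v ∈ periodicPts (H.pred s) := by
      by_contra h
      exact hw₀ (H.flow_eq_zero hs hf h)
    obtain ⟨c, hc⟩ := step _ (H.indicator_basin_mem (s := s) v)
    refine hC v hv (H.isBoundary_orbitEdges hs hf hv hw₀ fun u hu hne' => ?_)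
    refine H.exists_eq_iterate_of_mem_basin hu ?_
    by_contra hnot
    have h1 := hc _ (hor _ hw₀)
    have h2 := hc _ (hor _ hne')
    rw [hs, Set.indicator_of_mem (H.mem_basin_self v)] at h1
    rw [hs, Set.indicator_of_notMem hnot, ← h1] at h2
    exact zero_ne_one h2

theorem finrank_cutFun [Finite U] (C : Set W) :
    Module.finrank ℝ (H.cutFun C) = Nat.card (H.cut C).ConnectedComponent := by
  have := Fintype.ofFinite (H.cut C).ConnectedComponent
  have hinj := LinearMap.funLeft_injective_of_surjective ℝ ℝ (H.cut C).connectedComponentMk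
    Quot.mk_surjective
  have hrange : LinearMap.range (LinearMap.funLeft ℝ ℝ (H.cut C).connectedComponentMk) =
      H.cutFun C := by
    ext f
    constructor
    · rintro ⟨g, rfl⟩ w hw
      exact congrArg g (SimpleGraph.ConnectedComponent.eq.2 (H.reachable_a_b hw))
    · intro hf
      refine ⟨fun K => f K.out, ?_⟩
      ext x
      refine H.eq_of_reachable (C := C) hf (SimpleGraph.ConnectedComponent.eq.1 ?_)
      exact Quot.out_eq _
  rw [← hrange, LinearMap.finrank_range_of_inj hinj, Module.finrank_fintype_fun_eq_card,
    Nat.card_eq_fintype_card]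

theorem orbitEdges_iterate {v : X} (hv : v ∈ periodicPts (H.pred s)) (n : ℕ) :
    H.orbitEdges s ((H.pred s)^[n] v) = H.orbitEdges s v := by
  ext w
  constructor
  · rintro ⟨j, rfl⟩
    exact ⟨j + n, by rw [iterate_add_apply]⟩
  · rintro ⟨j, rfl⟩
    obtain ⟨m, hm, hper⟩ := hv
    refine ⟨j + (m * n - n), ?_⟩
    rw [← iterate_add_apply, add_assoc, Nat.sub_add_cancel (Nat.le_mul_of_pos_left n hm),
      iterate_add_apply, (hper.mul_const n).eq]

/-- An invariant function is determined by one free value per cycle, namely the cycle into which a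
face is eventually carried. -/
theorem finrank_invFun [Finite W] [Finite X] (hs : ∀ v, H.hd (s v) = v) :
    Module.finrank ℝ (H.invFun s) =
      {C | ∃ v ∈ periodicPts (H.pred s), C = H.orbitEdges s v}.ncard := by
  obtain ⟨M, hM⟩ := exists_iterate_mem_periodicPts (H.pred s)
  set 𝒞 : Set (Set W) := {C | ∃ v ∈ periodicPts (H.pred s), C = H.orbitEdges s v} with h𝒞
  have := Fintype.ofFinite 𝒞
  let cyc : X → 𝒞 := fun v => ⟨H.orbitEdges s ((H.pred s)^[M] v), _, hM v, rfl⟩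
  have hsurj : Surjective cyc := by
    rintro ⟨_, v, hv, rfl⟩
    exact ⟨v, Subtype.ext (H.orbitEdges_iterate hv M)⟩
  have hinj := LinearMap.funLeft_injective_of_surjective ℝ ℝ cyc hsurj
  have hcyc : ∀ v, cyc (H.pred s v) = cyc v := by
    intro v
    apply Subtype.ext
    change H.orbitEdges s ((H.pred s)^[M] ((H.pred s)^[1] v)) = H.orbitEdges s ((H.pred s)^[M] v)
    rw [← iterate_add_apply, add_comm, iterate_add_apply, H.orbitEdges_iterate (hM v)]
  have hrange : LinearMap.range (LinearMap.funLeft ℝ ℝ cyc) = H.invFun s := by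
    ext p
    constructor
    · rintro ⟨g, rfl⟩ v
      exact congrArg g (hcyc v)
    · intro hp
      choose r hr using hsurj
      refine ⟨fun C => p (r C), ?_⟩
      ext v
      have h1 : H.orbitEdges s ((H.pred s)^[M] (r (cyc v))) = H.orbitEdges s ((H.pred s)^[M] v) :=
        congrArg Subtype.val (hr (cyc v))
      have h2 : s ((H.pred s)^[M] v) ∈ H.orbitEdges s ((H.pred s)^[M] (r (cyc v))) := by
        rw [h1]
        exact ⟨0, rfl⟩
      obtain ⟨j, hj⟩ := h2
      have h3 := H.section_injective hs hj
      change p (r (cyc v)) = p v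
      rw [← H.invFun_iterate hp M v, h3, H.invFun_iterate hp, H.invFun_iterate hp]
  rw [← hrange, LinearMap.finrank_range_of_inj hinj, Module.finrank_fintype_fun_eq_card,
    ← Nat.card_eq_fintype_card, Nat.card_coe_set_eq]

/-! ### Counting matchings -/

/-- A perfect matching between the edges and the faces and vertices, in which the chosen edges are
matched to the faces they point to and all edges are matched to their heads or endpoints. -/
def IsMatching (s : X → W) (m : W ≃ X ⊕ U) : Prop :=
  (∀ w, m w = Sum.inl (H.hd w) ∨ m w = Sum.inr (H.a w) ∨ m w = Sum.inr (H.b w)) ∧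
    ∀ v, m (s v) = Sum.inl v

section Matching

variable {H} {m : W ≃ X ⊕ U}

theorem IsMatching.eq_or (hm : H.IsMatching s m) {w : W} (hw : w ∉ Set.range s) :
    m w = Sum.inr (H.a w) ∨ m w = Sum.inr (H.b w) := by
  refine (hm.1 w).resolve_left fun h => hw ⟨H.hd w, ?_⟩
  rw [← hm.2] at h
  exact (m.injective h).symm

open Classical in
-- The right-hand side does not depend on `m`, so the indicators of two matchings differ by a flow.
theorem IsMatching.sum_mul (hm : H.IsMatching s m) [Fintype W] [Fintype X] [Fintype U] (g : U → ℝ) :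
    ∑ w, (if m w = Sum.inr (H.a w) then (1 : ℝ) else 0) * (g (H.a w) - g (H.b w)) =
      ∑ x, g x - ∑ w, if w ∈ Set.range s then 0 else g (H.b w) := by
  have h1 : ∑ w, (Sum.elim 0 g : X ⊕ U → ℝ) (m w) = ∑ x, g x := by
    rw [Equiv.sum_comp m (Sum.elim 0 g), Fintype.sum_sum_type]
    simp
  rw [← h1, ← Finset.sum_sub_distrib]
  refine Finset.sum_congr rfl fun w _ => ?_
  by_cases hw : w ∈ Set.range s
  · obtain ⟨v, rfl⟩ := hw
    simp [hm.2]
  · rw [if_neg hw]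
    rcases hm.eq_or hw with h | h
    · simp [h]
    · simp [h, (H.a_ne_b w w).symm]

end Matching

open Classical in
/-- The number of matchings is `2` to the number of components, if each component carries a
nonzero real cycle. -/
theorem card_matchings [Fintype W] [Fintype X] [Fintype U] (hs : ∀ v, H.hd (s v) = v)
    (hflow : ∀ K : (H.cut (Set.range s)).ConnectedComponent,
      ∃ φ ∈ H.flows (Set.range s), (∀ w, H.a w ∉ K.supp → φ w = 0) ∧ ∃ w, φ w ≠ 0) :
    Nat.card {m : W ≃ X ⊕ U // H.IsMatching s m} =
      2 ^ Nat.card (H.cut (Set.range s)).ConnectedComponent := by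
  set G := H.cut (Set.range s) with hG
  have := Fintype.ofFinite G.ConnectedComponent
  choose φ hφ hsupp e he using hflow
  have hsupp' : ∀ K w, φ K w ≠ 0 → G.connectedComponentMk (H.a w) = K := fun K w h => by
    by_contra h'
    exact h (hsupp K w h')
  have heK : ∀ K, G.connectedComponentMk (H.a (e K)) = K := fun K => hsupp' K _ (he K)
  have heS : ∀ K, e K ∉ Set.range s := fun K h => he K ((hφ K).1 _ h)
  have hzero : ∀ K K', K ≠ K' → φ K (e K') = 0 := by
    intro K K' h
    by_contra h'
    exact h ((hsupp' K _ h').symm.trans (heK K'))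
  -- The `φ K` have disjoint supports and are as many as the dimension of `flows`, so a flow is
  -- determined by its values at the edges `e K`.
  have huniq : ∀ ψ ∈ H.flows (Set.range s), (∀ K, ψ (e K) = 0) → ψ = 0 := by
    let ev : H.flows (Set.range s) →ₗ[ℝ] (G.ConnectedComponent → ℝ) :=
      (LinearMap.funLeft ℝ ℝ e).comp (H.flows (Set.range s)).subtype
    have hev : ∀ ψ K, ev ψ K = ψ.1 (e K) := fun _ _ => rfl
    have hrank : Module.finrank ℝ (H.flows (Set.range s)) =
        Module.finrank ℝ (G.ConnectedComponent → ℝ) := by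
      rw [H.finrank_flows hs, H.finrank_cutFun, Module.finrank_fintype_fun_eq_card,
        Nat.card_eq_fintype_card]
    have hsurj : Surjective ev := by
      intro y
      refine ⟨∑ K, (y K / φ K (e K)) • ⟨φ K, hφ K⟩, ?_⟩
      ext K'
      rw [map_sum, Finset.sum_apply, Finset.sum_eq_single K']
      · rw [map_smul, Pi.smul_apply, hev, smul_eq_mul, div_mul_cancel₀ _ (he K')]
      · intro K _ hK
        rw [map_smul, Pi.smul_apply, hev]
        simp only [hzero K K' hK, smul_zero]
      · simp
    have hinj : Injective ev :=
      (LinearMap.injective_iff_surjective_of_finrank_eq_finrank hrank).2 hsurj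
    intro ψ hψ h0
    have : (⟨ψ, hψ⟩ : H.flows (Set.range s)) = 0 := hinj (by
      ext K
      rw [map_zero]
      exact h0 K)
    exact congrArg Subtype.val this
  let F : {m : W ≃ X ⊕ U // H.IsMatching s m} → (G.ConnectedComponent → Bool) :=
    fun m K => decide (m.1 (e K) = Sum.inr (H.a (e K)))
  have hFinj : Injective F := by
    rintro ⟨m, hm⟩ ⟨m', hm'⟩ h
    have hψ := huniq (fun w => (if m w = Sum.inr (H.a w) then (1 : ℝ) else 0) -
      (if m' w = Sum.inr (H.a w) then (1 : ℝ) else 0)) ⟨by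
        rintro _ ⟨v, rfl⟩
        simp [hm.2, hm'.2], fun g => by
        simp only [sub_mul, Finset.sum_sub_distrib]
        rw [hm.sum_mul, hm'.sum_mul, sub_self]⟩ (fun K => by
        have : m (e K) = Sum.inr (H.a (e K)) ↔ m' (e K) = Sum.inr (H.a (e K)) :=
          decide_eq_decide.1 (congrFun h K)
        simp only [this, sub_self])
    apply Subtype.ext
    ext1 w
    by_cases hw : w ∈ Set.range s
    · obtain ⟨v, rfl⟩ := hw
      exact (hm.2 v).trans (hm'.2 v).symm
    · have h1 := congrFun hψ w
      rcases hm.eq_or hw with h2 | h2 <;> rcases hm'.eq_or hw with h3 | h3 <;>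
        simp_all [(H.a_ne_b w w).symm]
  have hFsurj : Surjective F := by
    intro t
    -- The prescribed end of each `e K` becomes a unit row and every other unchosen edge a row `a -
    -- b`; a nonzero term in the determinant of this matrix is a matching with the prescribed
    -- values.
    let τ : W → U := fun w => if t (G.connectedComponentMk (H.a w)) then H.a w else H.b w
    let row : W → X ⊕ U → ℝ := fun w =>
      if w ∈ Set.range s then Pi.single (Sum.inl (H.hd w)) 1
      else if w = e (G.connectedComponentMk (H.a w)) then Pi.single (Sum.inr (τ w)) 1
      else Pi.single (Sum.inr (H.a w)) 1 - Pi.single (Sum.inr (H.b w)) 1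
    have row1 : ∀ v, row (s v) = Pi.single (Sum.inl v) 1 := by
      intro v
      simp [row, hs]
    have row2 : ∀ K, row (e K) = Pi.single (Sum.inr (τ (e K))) 1 := by
      intro K
      simp only [row, if_neg (heS K), heK, if_true]
    have row3 : ∀ w, w ∉ Set.range s → (∀ K, w ≠ e K) →
        row w = Pi.single (Sum.inr (H.a w)) 1 - Pi.single (Sum.inr (H.b w)) 1 := by
      intro w h1 h2
      simp only [row, if_neg h1, if_neg (h2 _)]
    have hτ : ∀ w, τ w = H.a w ∨ τ w = H.b w := fun w => by
      simp only [τ]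
      split_ifs <;> simp
    have e₀ : W ≃ X ⊕ U := Fintype.equivOfCardEq (by
      have := H.card_eq
      simpa [Nat.card_eq_fintype_card] using this)
    have hdet : (Matrix.of fun i => row (e₀.symm i)).det ≠ 0 := by
      intro h0
      obtain ⟨y, hy0, hy⟩ := Matrix.exists_mulVec_eq_zero_iff.2 h0
      have hrow : ∀ w, row w ⬝ᵥ y = 0 := by
        intro w
        have := congrFun hy (e₀ w)
        simpa [Matrix.mulVec, Matrix.of_apply] using this
      have hX : ∀ v, y (Sum.inl v) = 0 := by
        intro v
        have := hrow (s v)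
        rwa [row1, single_one_dotProduct] at this
      have h1 : ∀ w, w ∉ Set.range s → (∀ K, w ≠ e K) →
          y (Sum.inr (H.a w)) = y (Sum.inr (H.b w)) := by
        intro w hw hw'
        have := hrow w
        rw [row3 w hw hw', sub_dotProduct, single_one_dotProduct, single_one_dotProduct] at this
        exact sub_eq_zero.1 this
      have h2 : ∀ K, y (Sum.inr (τ (e K))) = 0 := by
        intro K
        have := hrow (e K)
        rwa [row2, single_one_dotProduct] at this
      -- In the pairing of `φ K` with the differences of `y`, only the term of `e K` can survive.
      have h3 : ∀ K, y (Sum.inr (H.a (e K))) = y (Sum.inr (H.b (e K))) := by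
        intro K
        have := (hφ K).2 (fun x => y (Sum.inr x))
        rw [Finset.sum_eq_single (e K)] at this
        · exact sub_eq_zero.1 ((mul_eq_zero.1 this).resolve_left (he K))
        · intro w _ hw
          by_cases hwS : w ∈ Set.range s
          · rw [(hφ K).1 w hwS, zero_mul]
          · by_cases hwe : ∀ K', w ≠ e K'
            · rw [h1 w hwS hwe, sub_self, mul_zero]
            · push Not at hwe
              obtain ⟨K', rfl⟩ := hwe
              rw [hzero K K' (fun h => hw (by rw [h])), zero_mul]
        · simp
      have hcut : ∀ w, w ∉ Set.range s → y (Sum.inr (H.a w)) = y (Sum.inr (H.b w)) := by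
        intro w hw
        by_cases hwe : ∀ K, w ≠ e K
        · exact h1 w hw hwe
        · push Not at hwe
          obtain ⟨K, rfl⟩ := hwe
          exact h3 K
      apply hy0
      ext i
      rcases i with v | x
      · exact hX v
      · have hreach := SimpleGraph.ConnectedComponent.eq.1 (heK (G.connectedComponentMk x))
        have h4 := H.eq_of_reachable (f := fun x => y (Sum.inr x)) hcut hreach
        rw [Pi.zero_apply, ← h4]
        rcases hτ (e (G.connectedComponentMk x)) with h5 | h5
        · rw [← h5, h2]
        · rw [h3, ← h5, h2]
    rw [Matrix.det_apply] at hdet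
    obtain ⟨σ, -, hσ⟩ := Finset.exists_ne_zero_of_sum_ne_zero hdet
    have hprod : ∏ i, (Matrix.of fun i => row (e₀.symm i)) (σ i) i ≠ 0 := by
      intro h
      exact hσ (by rw [h, smul_zero])
    rw [Finset.prod_ne_zero_iff] at hprod
    let m : W ≃ X ⊕ U := (σ.trans e₀.symm).symm
    have hm0 : ∀ w, row w (m w) ≠ 0 := by
      intro w
      have := hprod (m w) (Finset.mem_univ _)
      have h2 : e₀.symm (σ (m w)) = w := (σ.trans e₀.symm).apply_symm_apply w
      rwa [Matrix.of_apply, h2] at this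
    have hsingle : ∀ w i, row w = Pi.single i 1 → m w = i := by
      intro w i h
      by_contra h'
      have := hm0 w
      rw [h, Pi.single_eq_of_ne h'] at this
      exact this rfl
    have hm : H.IsMatching s m := by
      refine ⟨fun w => ?_, fun v => hsingle _ _ (row1 v)⟩
      by_cases hw : w ∈ Set.range s
      · obtain ⟨v, rfl⟩ := hw
        left
        rw [hs]
        exact hsingle _ _ (row1 v)
      · right
        by_cases hwe : ∀ K, w ≠ e K
        · by_contra! h
          have := hm0 w
          rw [row3 w hw hwe, Pi.sub_apply, Pi.single_eq_of_ne h.1, Pi.single_eq_of_ne h.2] at this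
          exact this (sub_self 0)
        · push Not at hwe
          obtain ⟨K, rfl⟩ := hwe
          rw [hsingle _ _ (row2 K)]
          rcases hτ (e K) with h | h <;> simp [h]
    refine ⟨⟨m, hm⟩, ?_⟩
    ext K
    have h1 := hsingle _ _ (row2 K)
    simp only [F, h1, τ, heK]
    rcases h : t K <;> simp [(H.a_ne_b _ _).symm]
  rw [Nat.card_congr (Equiv.ofBijective F ⟨hFinj, hFsurj⟩), Nat.card_eq_fintype_card,
    Nat.card_eq_fintype_card, Fintype.card_fun, Fintype.card_bool]

/-- If no cycle formed by the chosen edges separates, then there are `2 ^ k` matchings extending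
the choice, where `k` is the number of cycles. -/
theorem card_matchings_eq [Finite W] [Finite X] [Finite U] (hs : ∀ v, H.hd (s v) = v)
    (hC : ∀ v ∈ periodicPts (H.pred s), (H.cut (H.orbitEdges s v)).Connected) :
    Nat.card {m : W ≃ X ⊕ U // H.IsMatching s m} =
      2 ^ {C | ∃ v ∈ periodicPts (H.pred s), C = H.orbitEdges s v}.ncard := by
  have := Fintype.ofFinite W
  have := Fintype.ofFinite X
  have := Fintype.ofFinite U
  have hC' : ∀ v ∈ periodicPts (H.pred s), ¬ H.IsBoundary (H.orbitEdges s v) := fun v hv h =>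
    H.not_connected_of_isBoundary (C := H.orbitEdges s v) ⟨s v, 0, rfl⟩ h (hC v hv)
  rw [H.card_matchings hs, ← H.finrank_cutFun, ← H.finrank_invFun hs,
    (H.finrank_cutFun_le hs hC').antisymm (H.finrank_invFun_le hs)]
  intro K
  refine H.exists_flow_of_component hs hC' (K := K.supp) ?_ K.nonempty_supp ?_
  · intro w hw
    have := SimpleGraph.ConnectedComponent.eq.2 (H.reachable_a_b hw)
    simp only [SimpleGraph.ConnectedComponent.mem_supp_iff, this]
  · intro f hf x hx y hy
    exact H.eq_of_reachable (C := Set.range s) hf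
      (SimpleGraph.ConnectedComponent.eq.1 (hx.trans hy.symm))

end ToricMap

/-! ### From trinities to bipartite maps -/

theorem TrinityColor.exists_others (c : TrinityColor) :
    ∃ d e : TrinityColor, c ≠ d ∧ c ≠ e ∧ d ≠ e ∧ ∀ y, y = c ∨ y = d ∨ y = e := by
  revert c
  decide

namespace Trinity

variable {W B : Type*} (T : Trinity W B)

theorem blackVertex_glue {x y : TrinityColor} (h : x ≠ y) (w : W) :
    T.blackVertex (T.glue x w) y = T.whiteVertex w y :=
  (Quot.sound ⟨w, x, y, h, rfl, rfl⟩).symm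

theorem whiteVertex_eq {x x' y : TrinityColor} (h : x ≠ y) (h' : x' ≠ y) {w w' : W}
    (hw : T.glue x w = T.glue x' w') : T.whiteVertex w y = T.whiteVertex w' y := by
  rw [← T.blackVertex_glue h, hw, T.blackVertex_glue h']

@[simp]
theorem color_whiteVertex (w : W) (y : TrinityColor) : T.color (T.whiteVertex w y) = y := rfl

theorem exists_vertex_fun {x₀ y : TrinityColor} (F : W → ℝ)
    (hF : ∀ x, x ≠ y → ∀ w, F ((T.glue x₀).symm (T.glue x w)) = F w) :
    ∃ f : T.Vertex → ℝ, ∀ w, f (T.whiteVertex w y) = F w := by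
  refine ⟨Quot.lift (fun p => if p.2 = y then Sum.elim F (fun b => F ((T.glue x₀).symm b)) p.1
    else 0) ?_, fun w => if_pos rfl⟩
  rintro _ _ ⟨w, x, z, hne, rfl, rfl⟩
  by_cases hz : z = y
  · subst hz
    simp [hF x hne]
  · simp [hz]

theorem exists_whiteVertex {x₀ c : TrinityColor} (h : x₀ ≠ c) (v : T.Vertex)
    (hv : T.color v = c) : ∃ w, T.whiteVertex w c = v := by
  induction v using Quot.ind with
  | mk p =>
    obtain ⟨t | t, y⟩ := p
    · obtain rfl : y = c := hv
      exact ⟨t, rfl⟩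
    · obtain rfl : y = c := hv
      refine ⟨(T.glue x₀).symm t, ?_⟩
      rw [← T.blackVertex_glue h, Equiv.apply_symm_apply]
      rfl

theorem const_of_glue (hT : (SimpleGraph.fromRel T.GluedTriangles).Connected) {c : TrinityColor}
    {F : W → ℝ} (hF : ∀ x w, F ((T.glue c).symm (T.glue x w)) = F w) (w w' : W) : F w = F w' := by
  have key : ∀ s t : W ⊕ B, (SimpleGraph.fromRel T.GluedTriangles).Walk s t →
      Sum.elim F (fun b => F ((T.glue c).symm b)) s =
        Sum.elim F (fun b => F ((T.glue c).symm b)) t := by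
    intro s t p
    induction p with
    | nil => rfl
    | cons hadj _ ih =>
      rw [← ih]
      obtain ⟨-, ⟨w, x, rfl, rfl⟩ | ⟨w, x, rfl, rfl⟩⟩ := (SimpleGraph.fromRel_adj _ _ _).1 hadj
      · exact (hF x w).symm
      · exact hF x w
  obtain ⟨p⟩ := hT.preconnected (Sum.inl w) (Sum.inl w')
  exact key _ _ p

instance [Finite W] [Finite B] : Finite T.Vertex :=
  inferInstanceAs (Finite (Quot T.GluedCorners))

open Classical in
/-- The vertices, sorted by whether they have the colour `c`. -/
noncomputable def vertexEquiv (c : TrinityColor) :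
    {x : T.Vertex // T.color x = c} ⊕ {x : T.Vertex // T.color x ≠ c} ≃ T.Vertex :=
  Equiv.sumCompl fun x => T.color x = c

/-- With `3|W|` edges and `2|W|` triangles, Euler characteristic 0 means that there are `|W|`
vertices. -/
theorem card_white [Finite W] [Finite B] (hT : T.eulerChar = 0) (c : TrinityColor) :
    Nat.card W = Nat.card {x : T.Vertex // T.color x = c} +
      Nat.card {x : T.Vertex // T.color x ≠ c} := by
  have h3 : Nat.card TrinityColor = 3 := by
    rw [Nat.card_eq_fintype_card]
    rfl
  have hB := Nat.card_congr (T.glue c)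
  rw [← Nat.card_sum, Nat.card_congr (T.vertexEquiv c)]
  rw [eulerChar, Nat.card_prod, Nat.card_sum, h3, ← hB] at hT
  push_cast at hT
  omega

/-- The graph of the edges of colour `c` of a toric trinity as a bipartite map. -/
def toToricMap [Finite W] [Finite B] (hT : T.IsToric) {c d e : TrinityColor} (hcd : c ≠ d)
    (hce : c ≠ e) (hde : d ≠ e) (hall : ∀ y, y = c ∨ y = d ∨ y = e) :
    ToricMap W {x : T.Vertex // T.color x = c} {x : T.Vertex // T.color x ≠ c} where
  δ := (T.glue c).trans (T.glue d).symm
  ε := (T.glue c).trans (T.glue e).symm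
  hd w := ⟨T.whiteVertex w c, T.color_whiteVertex w c⟩
  a w := ⟨T.whiteVertex w d, hcd.symm⟩
  b w := ⟨T.whiteVertex w e, hce.symm⟩
  hd_surjective := by
    rintro ⟨v, hv⟩
    obtain ⟨w, rfl⟩ := T.exists_whiteVertex hcd.symm v hv
    exact ⟨w, rfl⟩
  a_ε w := Subtype.ext (T.whiteVertex_eq (x := e) (x' := c) hde.symm hcd (by simp))
  b_δ w := Subtype.ext (T.whiteVertex_eq (x := d) (x' := c) hde hce (by simp))
  hd_δ w := Subtype.ext (T.whiteVertex_eq (x := d) (x' := e) hcd.symm hce.symm (by simp))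
  a_ne_b w w' h := hde (congrArg T.color (congrArg Subtype.val h))
  exists_end := by
    rintro ⟨v, hv⟩
    rcases hall (T.color v) with h | h | h
    · exact absurd h hv
    · obtain ⟨w, rfl⟩ := T.exists_whiteVertex hcd v h
      exact ⟨w, Or.inl rfl⟩
    · obtain ⟨w, rfl⟩ := T.exists_whiteVertex hce v h
      exact ⟨w, Or.inr rfl⟩
  lift_U := by
    intro F G hF hG
    obtain ⟨f, hf⟩ := T.exists_vertex_fun (x₀ := c) (y := d) F (by
      intro x hx w
      rcases hall x with rfl | rfl | rfl
      · simp
      · exact absurd rfl hx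
      · rw [← hF]
        simp)
    obtain ⟨g, hg⟩ := T.exists_vertex_fun (x₀ := c) (y := e) G (by
      intro x hx w
      rcases hall x with rfl | rfl | rfl
      · simp
      · rw [← hG]
        simp
      · exact absurd rfl hx)
    refine ⟨fun x => if T.color x.1 = d then f x.1 else g x.1, fun w => ?_, fun w => ?_⟩
    · exact (if_pos rfl).trans (hf w)
    · exact (if_neg hde.symm).trans (hg w)
  lift_X := by
    intro F hF
    obtain ⟨f, hf⟩ := T.exists_vertex_fun (x₀ := d) (y := c) F (by
      intro x hx w
      rcases hall x with rfl | rfl | rfl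
      · exact absurd rfl hx
      · simp
      · have := hF ((T.glue c).symm (T.glue x w))
        simpa using this)
    exact ⟨fun x => f x.1, hf⟩
  const_of_invariant := by
    intro F hδ hε
    refine T.const_of_glue hT.1 (c := c) fun x w => ?_
    rcases hall x with rfl | rfl | rfl
    · simp
    · rw [← hδ]
      simp
    · rw [← hε]
      simp
  nonempty := by
    obtain ⟨w | b⟩ := hT.1.nonempty
    · exact ⟨w⟩
    · exact ⟨(T.glue c).symm b⟩
  card_eq := T.card_white hT.2 c

/-! ### Cycles, wreaths and Tutte matchings in terms of sections -/

section

variable [Finite W] [Finite B] (hT : T.IsToric) {c d e : TrinityColor} (hcd : c ≠ d)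
    (hce : c ≠ e) (hde : d ≠ e) (hall : ∀ y, y = c ∨ y = d ∨ y = e)

theorem tail_eq (w : W) :
    T.tail c w = ((T.toToricMap hT hcd hce hde hall).tl w).1 := by
  change T.blackVertex (T.glue c w) c = T.whiteVertex ((T.glue e).symm (T.glue c w)) c
  rw [← T.blackVertex_glue hce.symm, Equiv.apply_symm_apply]

theorem complementGraph_eq_cut (C : Set W) :
    T.complementGraph c C = (T.toToricMap hT hcd hce hde hall).cut C := by
  have key : ∀ (x : {x : T.Vertex // T.color x ≠ c}) (w : W),
      (∃ y, x.1 = T.whiteVertex w y) ↔ (x = (T.toToricMap hT hcd hce hde hall).a w ∨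
        x = (T.toToricMap hT hcd hce hde hall).b w) := by
    rintro ⟨x, hx⟩ w
    constructor
    · rintro ⟨y, rfl⟩
      rcases hall y with rfl | rfl | rfl
      · exact absurd rfl hx
      · exact Or.inl rfl
      · exact Or.inr rfl
    · rintro (h | h)
      · exact ⟨d, congrArg Subtype.val h⟩
      · exact ⟨e, congrArg Subtype.val h⟩
  ext x y
  change (x ≠ y ∧ ∃ w, w ∉ C ∧ _ ∧ _) ↔ (x ≠ y ∧ ∃ w, w ∉ C ∧ _ ∧ _)
  simp only [key]

/-- The cycles formed by a choice of incoming edges are its directed cycles. -/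
theorem isCycle_iff {s : {x : T.Vertex // T.color x = c} → W}
    (hs : ∀ v, (T.toToricMap hT hcd hce hde hall).hd (s v) = v) (C : Set W) :
    (C ⊆ Set.range s ∧ T.IsCycle c C) ↔
      ∃ v ∈ periodicPts ((T.toToricMap hT hcd hce hde hall).pred s),
        C = (T.toToricMap hT hcd hce hde hall).orbitEdges s v := by
  set H := T.toToricMap hT hcd hce hde hall with hH
  have hhead : ∀ v, T.head c (s v) = v.1 := fun v => congrArg Subtype.val (hs v)
  have htail : ∀ v, T.tail c (s v) = (H.pred s v).1 := fun v => T.tail_eq hT hcd hce hde hall (s v)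
  constructor
  · rintro ⟨hCs, m, v, e', hm, hv, he, rfl, hedge⟩
    have : NeZero m := ⟨hm.ne'⟩
    have hx : ∀ i, ∃ x, s x = e' i := fun i => hCs ⟨i, rfl⟩
    choose x hx using hx
    have hedge' : ∀ i, ((H.pred s (x i)).1 = v i ∧ (x i).1 = v (i + 1)) ∨
        ((H.pred s (x i)).1 = v (i + 1) ∧ (x i).1 = v i) := by
      intro i
      have := hedge i
      rw [← hx i, hhead, htail, Sym2.eq_iff] at this
      exact this
    have hxinj : Injective x := by
      intro i j h
      apply he
      rw [← hx i, ← hx j, h]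
    have hnat : ∀ i : ZMod m, ((i.val : ℕ) : ZMod m) = i := fun i => ZMod.natCast_rightInverse i
    -- As no two chosen edges share a head, one edge traversed against its direction forces all to
    -- be.
    by_cases hcase : ∃ i, (x i).1 = v i
    · obtain ⟨i₀, hi₀⟩ := hcase
      have hback : ∀ n : ℕ, (x (i₀ - n)).1 = v (i₀ - n) := by
        intro n
        induction n with
        | zero => simpa using hi₀
        | succ n ih =>
          have h1 : i₀ - ((n + 1 : ℕ) : ZMod m) + 1 = i₀ - n := by push_cast; ring
          rcases hedge' (i₀ - ((n + 1 : ℕ) : ZMod m)) with h | h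
          · rw [h1, ← ih] at h
            -- Consecutive edges with the same head coincide, which happens only for a loop.
            have h2 := hxinj (Subtype.ext h.2)
            rw [h2]
            exact ih
          · exact h.2
      have hxv : ∀ i, (x i).1 = v i := by
        intro i
        have := hback (i₀ - i).val
        rwa [hnat, sub_sub_cancel] at this
      have hstep : ∀ i, H.pred s (x i) = x (i + 1) := by
        intro i
        apply Subtype.ext
        rw [hxv]
        rcases hedge' i with h | h
        · have h1 := h.2
          rw [hxv] at h1
          rw [h.1, h1]
        · exact h.1
      have hiter : ∀ n : ℕ, (H.pred s)^[n] (x 0) = x n := by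
        intro n
        induction n with
        | zero => simp
        | succ n ih => rw [iterate_succ_apply', ih, hstep]; push_cast; rfl
      refine ⟨x 0, mk_mem_periodicPts hm ?_, ?_⟩
      · change (H.pred s)^[m] (x 0) = x 0
        rw [hiter, ZMod.natCast_self]
      · ext w
        constructor
        · rintro ⟨i, rfl⟩
          exact ⟨i.val, by rw [hiter, hnat, hx]⟩
        · rintro ⟨j, rfl⟩
          exact ⟨j, by rw [hiter, hx]⟩
    · push Not at hcase
      have hlt : ∀ i, (H.pred s (x i)).1 = v i ∧ (x i).1 = v (i + 1) := fun i =>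
        (hedge' i).resolve_right fun h => hcase i h.2
      have hstep : ∀ i, H.pred s (x i) = x (i - 1) := by
        intro i
        apply Subtype.ext
        rw [(hlt i).1, (hlt (i - 1)).2, sub_add_cancel]
      have hiter : ∀ n : ℕ, (H.pred s)^[n] (x 0) = x (-n) := by
        intro n
        induction n with
        | zero => simp
        | succ n ih =>
          rw [iterate_succ_apply', ih, hstep]
          push_cast
          congr 1
          ring
      refine ⟨x 0, mk_mem_periodicPts hm ?_, ?_⟩
      · change (H.pred s)^[m] (x 0) = x 0
        rw [hiter, ZMod.natCast_self, neg_zero]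
      · ext w
        constructor
        · rintro ⟨i, rfl⟩
          exact ⟨(-i).val, by rw [hiter, hnat, neg_neg, hx]⟩
        · rintro ⟨j, rfl⟩
          exact ⟨-j, by rw [hiter, hx]⟩
  · rintro ⟨v, hv, rfl⟩
    refine ⟨?_, ?_⟩
    · rintro _ ⟨j, rfl⟩
      exact ⟨_, rfl⟩
    set m := minimalPeriod (H.pred s) v with hm
    have hpos : 0 < m := minimalPeriod_pos_of_mem_periodicPts hv
    have : NeZero m := ⟨hpos.ne'⟩
    have hinj : Injective fun i : ZMod m => (H.pred s)^[i.val] v := by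
      intro i j h
      exact ZMod.val_injective m (iterate_injOn_Iio_minimalPeriod (ZMod.val_lt i) (ZMod.val_lt j) h)
    refine ⟨m, fun i => ((H.pred s)^[i.val] v).1, fun i => s ((H.pred s)^[i.val] v), hpos,
      Subtype.val_injective.comp hinj, (H.section_injective hs).comp hinj, ?_, fun i => ?_⟩
    · ext w
      constructor
      · rintro ⟨i, rfl⟩
        exact ⟨i.val, rfl⟩
      · rintro ⟨j, rfl⟩
        refine ⟨(j : ZMod m), ?_⟩
        simp only [ZMod.val_natCast]
        rw [hm, iterate_mod_minimalPeriod_eq]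
    · have hsucc : (H.pred s)^[(i + 1).val] v = H.pred s ((H.pred s)^[i.val] v) := by
        rw [ZMod.val_add, ZMod.val_one_eq_one_mod, Nat.add_mod_mod, ← iterate_succ_apply' (H.pred s)]
        exact iterate_mod_minimalPeriod_eq
      simp only [hsucc, hhead, htail]
      exact Sym2.eq_swap

theorem isWreath_range {s : {x : T.Vertex // T.color x = c} → W}
    (hs : ∀ v, (T.toToricMap hT hcd hce hde hall).hd (s v) = v)
    (hC : ∀ v ∈ periodicPts ((T.toToricMap hT hcd hce hde hall).pred s),
      ((T.toToricMap hT hcd hce hde hall).cut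
        ((T.toToricMap hT hcd hce hde hall).orbitEdges s v)).Connected) :
    T.IsWreath c (Set.range s) := by
  refine ⟨fun x hx => ⟨s ⟨x, hx⟩, ⟨⟨_, rfl⟩, congrArg Subtype.val (hs ⟨x, hx⟩)⟩, ?_⟩, ?_⟩
  · rintro _ ⟨⟨v, rfl⟩, h⟩
    exact congrArg s (Subtype.ext ((congrArg Subtype.val (hs v)).symm.trans h))
  · intro C hCs hcyc
    obtain ⟨v, hv, rfl⟩ := (T.isCycle_iff hT hcd hce hde hall hs C).1 ⟨hCs, hcyc⟩
    rw [IsSeparating, not_not, T.complementGraph_eq_cut hT hcd hce hde hall]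
    exact hC v hv

theorem IsWreath.exists_section {S : Set W} (hS : T.IsWreath c S) :
    ∃ s : {x : T.Vertex // T.color x = c} → W,
      (∀ v, (T.toToricMap hT hcd hce hde hall).hd (s v) = v) ∧ Set.range s = S ∧
      ∀ v ∈ periodicPts ((T.toToricMap hT hcd hce hde hall).pred s),
        ((T.toToricMap hT hcd hce hde hall).cut
          ((T.toToricMap hT hcd hce hde hall).orbitEdges s v)).Connected := by
  choose s hs huniq using hS.1
  have hs' : ∀ v : {x : T.Vertex // T.color x = c},
      (T.toToricMap hT hcd hce hde hall).hd (s v.1 v.2) = v :=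
    fun v => Subtype.ext (hs v.1 v.2).2
  have hrange : Set.range (fun v : {x : T.Vertex // T.color x = c} => s v.1 v.2) = S := by
    ext w
    constructor
    · rintro ⟨v, rfl⟩
      exact (hs v.1 v.2).1
    · intro hw
      exact ⟨⟨T.head c w, rfl⟩, (huniq _ rfl w ⟨hw, rfl⟩).symm⟩
  refine ⟨fun v => s v.1 v.2, hs', hrange, fun v hv => ?_⟩
  obtain ⟨h1, h2⟩ := (T.isCycle_iff hT hcd hce hde hall hs' _).2 ⟨v, hv, rfl⟩
  have := hS.2 _ (hrange ▸ h1) h2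
  rwa [IsSeparating, not_not, T.complementGraph_eq_cut hT hcd hce hde hall] at this

/-- Tutte matchings that extend a choice of incoming edges, with vertices sorted by colour. -/
noncomputable def extendsEquiv {s : {x : T.Vertex // T.color x = c} → W}
    (hs : ∀ v, (T.toToricMap hT hcd hce hde hall).hd (s v) = v) :
    {m : T.TutteMatching // T.Extends c m (Set.range s)} ≃
      {m : W ≃ {x : T.Vertex // T.color x = c} ⊕ {x : T.Vertex // T.color x ≠ c} //
        (T.toToricMap hT hcd hce hde hall).IsMatching s m} where
  toFun m := ⟨m.1.1.trans (T.vertexEquiv c).symm, by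
    obtain ⟨⟨m, hm⟩, hext⟩ := m
    refine ⟨fun w => ?_, fun v => ?_⟩
    · simp only [Equiv.trans_apply, Equiv.symm_apply_eq]
      obtain ⟨y, hy⟩ := hm w
      rw [hy]
      rcases hall y with rfl | rfl | rfl
      · exact Or.inl rfl
      · exact Or.inr (Or.inl rfl)
      · exact Or.inr (Or.inr rfl)
    · simp only [Equiv.trans_apply, Equiv.symm_apply_eq]
      exact (hext _ ⟨v, rfl⟩).trans (congrArg Subtype.val (hs v))⟩
  invFun m := ⟨⟨m.1.trans (T.vertexEquiv c), by
    obtain ⟨m, hm⟩ := m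
    intro w
    simp only [Equiv.trans_apply]
    rcases hm.1 w with h | h | h
    · exact ⟨c, by rw [h]; rfl⟩
    · exact ⟨d, by rw [h]; rfl⟩
    · exact ⟨e, by rw [h]; rfl⟩⟩, by
    obtain ⟨m, hm⟩ := m
    rintro _ ⟨v, rfl⟩
    simp only [Equiv.trans_apply, hm.2]
    exact (congrArg Subtype.val (hs v)).symm⟩
  left_inv := by
    rintro ⟨⟨m, hm⟩, hext⟩
    apply Subtype.ext
    apply Subtype.ext
    ext1 w
    exact (T.vertexEquiv c).apply_symm_apply _
  right_inv := by
    rintro ⟨m, hm⟩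
    apply Subtype.ext
    ext1 w
    exact (T.vertexEquiv c).symm_apply_apply _

end

end Trinity

end

theorem mainTheorem11 {W B : Type*} [Finite W] [Finite B] (T : Trinity W B)
    (hT : T.IsToric) (c : TrinityColor) :
    (∀ S : Set W, T.IsWreath c S →
      Nat.card {m : T.TutteMatching // T.Extends c m S} = 2 ^ T.numCycles c S) ∧
    (∃ S : Set W, T.IsWreath c S) ∧
    Nonempty T.TutteMatching := by
  obtain ⟨d, e, hcd, hce, hde, hall⟩ := c.exists_others
  have hcount : ∀ S : Set W, T.IsWreath c S →
      Nat.card {m : T.TutteMatching // T.Extends c m S} = 2 ^ T.numCycles c S := by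
    intro S hS
    obtain ⟨s, hs, rfl, hC⟩ := hS.exists_section T hT hcd hce hde hall
    rw [Nat.card_congr (T.extendsEquiv hT hcd hce hde hall hs),
      (T.toToricMap hT hcd hce hde hall).card_matchings_eq hs hC, Trinity.numCycles]
    simp only [T.isCycle_iff hT hcd hce hde hall hs]
  have hex : ∃ S : Set W, T.IsWreath c S := by
    obtain ⟨s, hs, hC⟩ := (T.toToricMap hT hcd hce hde hall).exists_section_connected
    exact ⟨_, T.isWreath_range hT hcd hce hde hall hs hC⟩
  refine ⟨hcount, hex, ?_⟩
  obtain ⟨S, hS⟩ := hex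
  have hpos : Nat.card {m : T.TutteMatching // T.Extends c m S} ≠ 0 := by
    rw [hcount S hS]
    positivity
  have := (Nat.card_ne_zero.1 hpos).1
  exact this.map Subtype.val
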